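/- Let $n\ge 1$, $a,\ell\ge 0$ be integers with $$\ell>\ell_0:=2a^2\left(a+\tfrac n2-1\right)-\tfrac n2 ,$$ and let $T(x)=\sum_{|\mathbf i|=2a}\alpha_{\mathbf i}x^{\mathbf i}$ be a real homogeneous polynomial of degree $2a$ in $n$ variables. (Then $\ell\ge a$.) Let $\nu=\max_{x\in S^{n-1}}T(x)$ and $\nu_{\min}=\min_{x\in S^{n-1}}T(x)$, where $S^{n-1}$ is the Euclidean unit sphere of $\mathbb R^n$. A matrix $M\in\mathrm{End}((\mathbb R^n)^{\otimes k})$ is called *maximally symmetric* if, viewed as a vector in $(\mathbb R^n)^{\otimes 2k}$, it is invariant under all permutations of the $2k$ tensor factors. Let $\mathcal M(a,\ell)$ be the set of maximally symmetric $M\in\mathrm{End}((\mathbb R^n)^{\otimes a})$ for which there is a maximally symmetric $M_\ell\in\mathrm{End}((\mathbb R^n)^{\otimes \ell})$ with $M_\ell\ge 0$, $\operatorname{tr}M_\ell=1$ and $\operatorname{tr}_{a+1,\dots,\ell}(M_\ell)=M$ (partial trace over the last $\ell-a$ factors). Let $Z_T\in\mathrm{End}((\mathbb R^n)^{\otimes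 a})$ be the polynomial matrix of $T$, i.e. the maximally symmetric matrix with $\langle x^{\otimes a},Z_T\,x^{\otimes a}\rangle=T(x)$ for all $x$; its entry at a pair of standard product basis vectors in which each basis vector $e_t$ of $\mathbb R^n$ occurs $i_t$ times in total is $\frac{i_1!\cdots i_n!}{(2a)!}\,\alpha_{\mathbf i}$. The level-$\ell$ relaxation is the semidefinite program of maximizing $\operatorname{tr}(Z_TM)$ over $M\in\mathcal M(a,\ell)$. Then this program has an optimal value $\nu_\ell$ (it is attained), and $$|\nu_\ell-\nu|\le \varepsilon(a,\ell,n)\,(\nu-\nu_{\min}),\qquad \varepsilon(a,\ell,n)=\frac{4a^2\left(a+\frac n2-1\right)}{2\ell+n}.$$ -/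

import Mathlib

/-- A real matrix acting on the `k`-fold tensor power of `ℝⁿ`. The standard product basis vectors
`e_{u 0} ⊗ ⋯ ⊗ e_{u (k-1)}` are indexed by the words `u : Fin k → Fin n`. -/
abbrev TensorMatrix (n k : ℕ) : Type :=
  Matrix (Fin k → Fin n) (Fin k → Fin n) ℝ

/-- The vectorization of `M`, an element of the `2k`-fold tensor power of `ℝⁿ`. The `2k` tensor
factors are indexed by `Fin k ⊕ Fin k`: the row systems followed by the column systems. -/
def vectorize {n k : ℕ} (M : TensorMatrix n k) (w : Fin k ⊕ Fin k → Fin n) : ℝ :=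
  M (fun i => w (Sum.inl i)) (fun i => w (Sum.inr i))

/-- `M` is maximally symmetric: its vectorization is invariant under all permutations of the
`2k` tensor factors. -/
def IsMaxSymmetric {n k : ℕ} (M : TensorMatrix n k) : Prop :=
  ∀ (π : Equiv.Perm (Fin k ⊕ Fin k)) (w : Fin k ⊕ Fin k → Fin n),
    vectorize M (fun i => w (π i)) = vectorize M w

/-- The word of length `l` whose first `a` letters are `u` and whose remaining letters are `w`. -/
def joinWords {n a l : ℕ} (h : a ≤ l) (u : Fin a → Fin n) (w : Fin (l - a) → Fin n) :
    Fin l → Fin n :=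
  fun i => if hi : (i : ℕ) < a then u ⟨i, hi⟩ else w ⟨(i : ℕ) - a, by omega⟩

/-- The partial trace over all tensor factors but the first `a`. -/
def partialTrace {n a l : ℕ} (h : a ≤ l) (M : TensorMatrix n l) : TensorMatrix n a :=
  fun u v => ∑ w : Fin (l - a) → Fin n, M (joinWords h u w) (joinWords h v w)

/-- The feasible set of the level-`l` relaxation: the maximally symmetric matrices on `a` systems
that extend to a maximally symmetric state (positive semidefinite with trace one) on `l ≥ a`
systems. -/
def relaxedMomentMatrices (n a l : ℕ) : Set (TensorMatrix n a) :=
  {M | IsMaxSymmetric M ∧ ∃ (h : a ≤ l) (N : TensorMatrix n l),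
    IsMaxSymmetric N ∧ N.PosSemidef ∧ N.trace = 1 ∧ partialTrace h N = M}

/-- The exponent vector of a word: letter `t` is sent to its number of occurrences. -/
noncomputable def wordExponent {n k : ℕ} (u : Fin k → Fin n) : Fin n →₀ ℕ :=
  ∑ i : Fin k, Finsupp.single (u i) 1

/-- The polynomial matrix `Z_T` of a homogeneous polynomial `T = ∑ αᵢ xⁱ` of degree `2a`. Its
vectorization is `∑ᵢ √(i! / (2a)!) αᵢ |i⟩`, where `|i⟩` is the normalized symmetrization of the
product basis vectors with exponent `i`, all of whose nonzero entries are `√(i! / (2a)!)`. Hence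
the entry at a pair of words of total exponent `i` is `(i! / (2a)!) αᵢ`. It is the unique maximally
symmetric matrix with `⟨x^{⊗a}, Z_T x^{⊗a}⟩ = T(x)` for all `x`. -/
noncomputable def polynomialMatrix {n : ℕ} (a : ℕ) (T : MvPolynomial (Fin n) ℝ) :
    TensorMatrix n a :=
  fun u v =>
    ((∏ t : Fin n, Nat.factorial ((wordExponent u + wordExponent v) t) : ℕ) : ℝ)
      / (Nat.factorial (2 * a) : ℝ) * T.coeff (wordExponent u + wordExponent v)

/-- The objective values `tr (Z_T M)` attained on the feasible set of the level-`l` relaxation. -/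
def relaxationValues {n : ℕ} (a l : ℕ) (T : MvPolynomial (Fin n) ℝ) : Set ℝ :=
  (fun M => (polynomialMatrix a T * M).trace) '' relaxedMomentMatrices n a l

/-- The values of `T` on the Euclidean unit sphere of `ℝⁿ`. -/
def sphereValues {n : ℕ} (T : MvPolynomial (Fin n) ℝ) : Set ℝ :=
  (fun x : EuclideanSpace ℝ (Fin n) => MvPolynomial.eval (fun i => x i) T) ''
    Metric.sphere (0 : EuclideanSpace ℝ (Fin n)) 1

/-! The inequality ν ≤ ν_ℓ holds because the pure states (x xᵀ)^{⊗ℓ}, |x| = 1, are feasible. For the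
upper bound let `N` extend a feasible `M`, and let h(y) = ⟨y^{⊗ℓ}, N y^{⊗ℓ}⟩ ≥ 0 be its Husimi
polynomial. For a standard Gaussian y, the Hermite transform exp(-Δ/2) T undoes the smoothing in h:
E[h · exp(-Δ/2) T] = C · tr(Z_T M) with C > 0 (`gaussianMean_husimi_mul_hermiteTransform`). Since h
is homogeneous, each term Δ^k T may be replaced by a suitable multiple of |y|^{2k} Δ^k T without
changing the mean. This gives a form D T of degree 2a (`gaussianMean_mul_deconvolution`). Hence
tr(Z_T M) ≤ c as soon as D(c|y|^{2a} - T) ≥ 0 pointwise.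

For c = ν + ε(ν - ν_min) put r = (ν - ν_min)/2 and write c|y|^{2a} - T = H + (1 + 2ε) r |y|^{2a},
where |H| ≤ r on the sphere. D multiplies |y|^{2a} by a scalar S ≥ 1 - ε/(2a). Banach's theorem on
symmetric multilinear forms gives |∂_i f| ≤ d · max |f| on the sphere for forms of degree d, hence
|D H| ≤ (1 + ∑ B_k) r. Finally 1 + ∑ B_k ≤ (1 + 2ε) S when ε ≤ 1
(`one_add_sum_deconvolutionBound_le`), and the lower bound on ℓ ensures ε ≤ 1. For a = 0 the
polynomial is constant and the relaxation is exact. -/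

open MvPolynomial MeasureTheory ProbabilityTheory

/-! ### Gaussian means of polynomials and integration by parts. -/

theorem integrable_pow_gaussianReal (k : ℕ) :
    Integrable (fun x : ℝ => x ^ k) (gaussianReal 0 1) := by
  have h := (memLp_id_gaussianReal (μ := 0) (v := 1) (k : NNReal)).integrable_norm_pow'
  refine (integrable_norm_iff (by fun_prop)).1 ?_
  simpa [norm_pow] using h

/-- The derivative of density times `x ^ k` integrates to zero. For `k = 0` the factor `k` makes the
truncated exponent `k - 1` harmless. -/
theorem integral_pow_succ_gaussianReal (k : ℕ) :
    ∫ x, x ^ (k + 1) ∂(gaussianReal 0 1) = k * ∫ x, x ^ (k - 1) ∂(gaussianReal 0 1) := by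
  have hint : ∀ m : ℕ, Integrable (fun x : ℝ => gaussianPDFReal 0 1 x * x ^ m) := by
    intro m
    have h := integrable_pow_gaussianReal m
    rw [gaussianReal_of_var_ne_zero _ (by norm_num : (1 : NNReal) ≠ 0),
      integrable_withDensity_iff_integrable_smul' (by fun_prop) (by simp [gaussianPDF])] at h
    refine h.congr (Filter.Eventually.of_forall fun x => ?_)
    simp [gaussianPDF, gaussianPDFReal_nonneg]
  have hderiv : ∀ x : ℝ, HasDerivAt (fun x : ℝ => gaussianPDFReal 0 1 x * x ^ k)
      (k * (gaussianPDFReal 0 1 x * x ^ (k - 1)) - gaussianPDFReal 0 1 x * x ^ (k + 1)) x := by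
    intro x
    have h1 : HasDerivAt (fun x : ℝ => gaussianPDFReal 0 1 x)
        (-x * gaussianPDFReal 0 1 x) x := by
      unfold gaussianPDFReal
      have h2 : HasDerivAt (fun x : ℝ => -(x - 0) ^ 2 / (2 * ((1 : NNReal) : ℝ))) (-x) x := by
        have := (((hasDerivAt_id x).sub_const (0 : ℝ)).pow 2).neg.div_const
          (2 * ((1 : NNReal) : ℝ))
        refine this.congr_deriv ?_
        simp
        ring
      refine (h2.exp.const_mul ((√(2 * Real.pi * ((1 : NNReal) : ℝ)))⁻¹)).congr_deriv ?_
      ring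
    refine (h1.mul (hasDerivAt_pow k x)).congr_deriv ?_
    ring
  have h0 := integral_eq_zero_of_hasDerivAt_of_integrable hderiv
    (((hint (k - 1)).const_mul k).sub (hint (k + 1))) (hint k)
  rw [integral_sub ((hint (k - 1)).const_mul k) (hint (k + 1)), integral_const_mul] at h0
  rw [integral_gaussianReal_eq_integral_smul (by norm_num),
    integral_gaussianReal_eq_integral_smul (by norm_num)]
  simp only [smul_eq_mul]
  linarith

/-- The standard Gaussian measure on `Fin n → ℝ`. -/
noncomputable abbrev stdGaussianPi (n : ℕ) : Measure (Fin n → ℝ) :=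
  Measure.pi fun _ => gaussianReal 0 1

theorem eval_monomial_eq_prod {n : ℕ} (s : Fin n →₀ ℕ) (r : ℝ) (y : Fin n → ℝ) :
    eval y (monomial s r) = r * ∏ i, y i ^ s i := by
  rw [eval_monomial, Finsupp.prod_fintype _ _ (by simp)]

theorem integrable_eval_stdGaussianPi {n : ℕ} (f : MvPolynomial (Fin n) ℝ) :
    Integrable (fun y => eval y f) (stdGaussianPi n) := by
  induction f using MvPolynomial.induction_on' with
  | monomial s r =>
    simp only [eval_monomial_eq_prod]
    exact (Integrable.fintype_prod (f := fun i (x : ℝ) => x ^ s i)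
      fun i => integrable_pow_gaussianReal (s i)).const_mul r
  | add p q hp hq =>
    simp only [map_add]
    exact hp.add hq

/-- The mean of a polynomial under the standard Gaussian measure. -/
noncomputable def gaussianMean (n : ℕ) : MvPolynomial (Fin n) ℝ →ₗ[ℝ] ℝ where
  toFun f := ∫ y, eval y f ∂(stdGaussianPi n)
  map_add' f g := by
    simp only [map_add]
    exact integral_add (integrable_eval_stdGaussianPi f) (integrable_eval_stdGaussianPi g)
  map_smul' c f := by
    simp only [smul_eval, RingHom.id_apply, smul_eq_mul]
    exact integral_const_mul _ _

theorem gaussianMean_nonneg {n : ℕ} {f : MvPolynomial (Fin n) ℝ} (hf : ∀ y, 0 ≤ eval y f) :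
    0 ≤ gaussianMean n f :=
  integral_nonneg hf

theorem gaussianMean_one {n : ℕ} : gaussianMean n 1 = 1 := by
  simp [gaussianMean]

theorem gaussianMean_monomial {n : ℕ} (s : Fin n →₀ ℕ) (r : ℝ) :
    gaussianMean n (monomial s r) = r * ∏ i, ∫ x, x ^ s i ∂(gaussianReal 0 1) := by
  simp only [gaussianMean, LinearMap.coe_mk, AddHom.coe_mk, eval_monomial_eq_prod]
  rw [integral_const_mul, integral_fintype_prod_eq_prod (fun i (x : ℝ) => x ^ s i)]

/-- Gaussian integration by parts. -/
theorem gaussianMean_X_mul {n : ℕ} (i : Fin n) (f : MvPolynomial (Fin n) ℝ) :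
    gaussianMean n (X i * f) = gaussianMean n (pderiv i f) := by
  induction f using MvPolynomial.induction_on' with
  | monomial s r =>
    rw [pderiv_monomial, X, monomial_mul, gaussianMean_monomial, gaussianMean_monomial,
      ← Finset.mul_prod_erase _ _ (Finset.mem_univ i),
      ← Finset.mul_prod_erase _ (fun j => ∫ x, x ^ ((s - Finsupp.single i 1 : Fin n →₀ ℕ) j)
        ∂(gaussianReal 0 1))
        (Finset.mem_univ i)]
    have h : ∀ j ∈ Finset.univ.erase i,
        ∫ x, x ^ ((Finsupp.single i 1 + s : Fin n →₀ ℕ) j) ∂(gaussianReal 0 1)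
          = ∫ x, x ^ ((s - Finsupp.single i 1 : Fin n →₀ ℕ) j) ∂(gaussianReal 0 1) := by
      intro j hj
      have hji : i ≠ j := fun h => (Finset.ne_of_mem_erase hj) h.symm
      simp [Finsupp.single_eq_of_ne' hji]
    rw [Finset.prod_congr rfl h]
    simp only [Finsupp.add_apply, Finsupp.single_eq_same, Finsupp.tsub_apply, add_comm 1 (s i),
      integral_pow_succ_gaussianReal]
    ring
  | add p q hp hq => simp only [mul_add, map_add, hp, hq]

/-! ### The Laplacian and the Hermite transform. -/

/-- The squared Euclidean norm as a polynomial. -/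
noncomputable def sqNorm (n : ℕ) : MvPolynomial (Fin n) ℝ := ∑ i, X i ^ 2

/-- The Laplace operator on polynomials. -/
noncomputable def laplacian (n : ℕ) : MvPolynomial (Fin n) ℝ →ₗ[ℝ] MvPolynomial (Fin n) ℝ :=
  ∑ i, (pderiv i).toLinearMap ∘ₗ (pderiv i).toLinearMap

theorem laplacian_apply {n : ℕ} (f : MvPolynomial (Fin n) ℝ) :
    laplacian n f = ∑ i, pderiv i (pderiv i f) := by
  simp [laplacian]

theorem pderiv_pderiv_comm {n : ℕ} (i j : Fin n) (f : MvPolynomial (Fin n) ℝ) :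
    pderiv i (pderiv j f) = pderiv j (pderiv i f) := by
  have h : ⁅pderiv (R := ℝ) i, pderiv j⁆
      = (0 : Derivation ℝ (MvPolynomial (Fin n) ℝ) (MvPolynomial (Fin n) ℝ)) := by
    refine derivation_ext fun k => ?_
    rw [Derivation.commutator_apply, pderiv_X, pderiv_X]
    simp only [Pi.single_apply]
    split_ifs <;> simp
  have h2 := congrArg (fun D => D f) h
  simpa [Derivation.commutator_apply, sub_eq_zero] using h2

theorem laplacian_pderiv {n : ℕ} (i : Fin n) (f : MvPolynomial (Fin n) ℝ) :
    laplacian n (pderiv i f) = pderiv i (laplacian n f) := by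
  simp only [laplacian_apply, map_sum]
  refine Finset.sum_congr rfl fun j _ => ?_
  rw [pderiv_pderiv_comm j i f, pderiv_pderiv_comm j i]

theorem laplacian_X_mul {n : ℕ} (i : Fin n) (f : MvPolynomial (Fin n) ℝ) :
    laplacian n (X i * f) = X i * laplacian n f + 2 * pderiv i f := by
  have h : ∀ j, pderiv j (pderiv j (X i * f))
      = X i * pderiv j (pderiv j f) + if j = i then 2 * pderiv i f else 0 := by
    intro j
    by_cases hj : j = i
    · subst hj
      simp only [Derivation.leibniz, pderiv_X_self, smul_eq_mul, map_add, if_true, mul_one]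
      ring
    · simp [Derivation.leibniz, pderiv_X_of_ne (Ne.symm hj), hj]
  simp only [laplacian_apply, h, Finset.sum_add_distrib, Finset.mul_sum, Finset.sum_ite_eq',
    Finset.mem_univ, if_true]

theorem laplacian_pow_succ_apply {n : ℕ} (k : ℕ) (f : MvPolynomial (Fin n) ℝ) :
    (laplacian n ^ (k + 1)) f = laplacian n ((laplacian n ^ k) f) := by
  rw [pow_succ', Module.End.mul_apply]

/-- The commutator [Δ, X_i] = 2∂_i commutes with Δ. -/
theorem laplacian_pow_X_mul {n : ℕ} (i : Fin n) (k : ℕ) (f : MvPolynomial (Fin n) ℝ) :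
    (laplacian n ^ (k + 1)) (X i * f) = X i * (laplacian n ^ (k + 1)) f
      + (2 * (k + 1 : ℝ)) • pderiv i ((laplacian n ^ k) f) := by
  induction k with
  | zero =>
    have h2 : (C 2 : MvPolynomial (Fin n) ℝ) = 2 := map_ofNat C 2
    simp [laplacian_X_mul, smul_eq_C_mul, h2]
  | succ k ih =>
    rw [laplacian_pow_succ_apply, ih, map_add, map_smul, laplacian_X_mul, laplacian_pderiv,
      ← laplacian_pow_succ_apply, ← laplacian_pow_succ_apply]
    simp only [smul_eq_C_mul, map_mul, map_add, map_ofNat, map_one, Nat.cast_succ]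
    ring

theorem MvPolynomial.IsHomogeneous.laplacian {n d : ℕ} {f : MvPolynomial (Fin n) ℝ}
    (hf : f.IsHomogeneous d) : (laplacian n f).IsHomogeneous (d - 2) := by
  rw [laplacian_apply]
  exact IsHomogeneous.sum _ _ _ fun i _ => hf.pderiv.pderiv

theorem MvPolynomial.IsHomogeneous.laplacian_pow {n d : ℕ} {f : MvPolynomial (Fin n) ℝ}
    (hf : f.IsHomogeneous d) (k : ℕ) : ((_root_.laplacian n ^ k) f).IsHomogeneous (d - 2 * k) := by
  induction k with
  | zero => simpa using hf
  | succ k ih =>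
    rw [laplacian_pow_succ_apply]
    have := ih.laplacian
    rwa [Nat.sub_sub] at this

theorem pderiv_eq_zero_of_isHomogeneous_zero {n : ℕ} {f : MvPolynomial (Fin n) ℝ}
    (hf : f.IsHomogeneous 0) (i : Fin n) : pderiv i f = 0 := by
  have h := totalDegree_eq_zero_iff_eq_C.1 (Nat.le_zero.1 hf.totalDegree_le)
  rw [h, pderiv_C]

theorem laplacian_pow_eq_zero {n d K : ℕ} {f : MvPolynomial (Fin n) ℝ}
    (hf : f.IsHomogeneous d) (hK : d < 2 * K) : (laplacian n ^ K) f = 0 := by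
  obtain _ | K := K
  · omega
  have h := (hf.laplacian_pow K)
  rw [laplacian_pow_succ_apply, laplacian_apply]
  refine Finset.sum_eq_zero fun i _ => pderiv_eq_zero_of_isHomogeneous_zero ?_ i
  -- Here `d - 2 * K ≤ 1`, so one derivative already leaves a constant and the second kills it.
  have h1 := h.pderiv (i := i)
  rwa [show d - 2 * K - 1 = 0 by omega] at h1

/-- The truncation to `K` terms of `exp (-Δ / 2) f`. -/
noncomputable def hermiteTransform (n K : ℕ) :
    MvPolynomial (Fin n) ℝ →ₗ[ℝ] MvPolynomial (Fin n) ℝ :=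
  ∑ k ∈ Finset.range K, ((-1) ^ k / (2 ^ k * k.factorial : ℝ)) • laplacian n ^ k

theorem hermiteTransform_apply {n : ℕ} (K : ℕ) (f : MvPolynomial (Fin n) ℝ) :
    hermiteTransform n K f
      = ∑ k ∈ Finset.range K, ((-1) ^ k / (2 ^ k * k.factorial : ℝ)) • (laplacian n ^ k) f := by
  simp [hermiteTransform]

/-- This is the Hermite recurrence. The commutator of Δ^{k+1} with X_i uses up one Laplacian, so the
derivative term is truncated one order earlier. -/
theorem hermiteTransform_X_mul {n : ℕ} (i : Fin n) (K : ℕ) (f : MvPolynomial (Fin n) ℝ) :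
    hermiteTransform n (K + 1) (X i * f)
      = X i * hermiteTransform n (K + 1) f - pderiv i (hermiteTransform n K f) := by
  simp only [hermiteTransform_apply]
  rw [Finset.sum_range_succ', Finset.sum_range_succ' (fun k => _ • (laplacian n ^ k) f), mul_add,
    Finset.mul_sum, map_sum, add_sub_right_comm, ← Finset.sum_sub_distrib]
  congr 1
  · refine Finset.sum_congr rfl fun k _ => ?_
    rw [laplacian_pow_X_mul, smul_add, smul_smul, mul_smul_comm, Derivation.map_smul, sub_eq_add_neg, ← neg_smul]
    congr 2
    have : (k.factorial : ℝ) ≠ 0 := by positivity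
    rw [Nat.factorial_succ]
    push_cast
    field_simp
    ring
  · simp

theorem hermiteTransform_eq_of_lt {n d K K' : ℕ} {f : MvPolynomial (Fin n) ℝ}
    (hf : f.IsHomogeneous d) (hK : d < 2 * K) (h : K ≤ K') :
    hermiteTransform n K' f = hermiteTransform n K f := by
  rw [hermiteTransform_apply, hermiteTransform_apply]
  refine (Finset.sum_subset (Finset.range_mono h) fun k _ hk => ?_).symm
  rw [Finset.mem_range, not_lt] at hk
  rw [laplacian_pow_eq_zero hf (by omega), smul_zero]

/-! ### Powers of linear forms against Hermite transforms; radial factors. -/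

/-- The linear form with coefficient vector `x`. -/
noncomputable def linForm {n : ℕ} (x : Fin n → ℝ) : MvPolynomial (Fin n) ℝ := ∑ i, x i • X i

theorem pderiv_linForm {n : ℕ} (x : Fin n → ℝ) (i : Fin n) : pderiv i (linForm x) = C (x i) := by
  simp [linForm, pderiv_X, Pi.single_apply, smul_eq_C_mul]

theorem pderiv_linForm_pow {n : ℕ} (x : Fin n → ℝ) (i : Fin n) (m : ℕ) :
    pderiv i (linForm x ^ m) = (m * x i) • linForm x ^ (m - 1) := by
  rw [Derivation.leibniz_pow, pderiv_linForm]
  simp only [smul_eq_C_mul, smul_eq_mul, nsmul_eq_mul, map_mul, map_natCast]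
  ring

theorem eval_sqNorm {n : ℕ} (x : Fin n → ℝ) : eval x (sqNorm n) = ∑ i, x i ^ 2 := by
  simp [sqNorm]

theorem gaussianMean_linForm_pow {n : ℕ} (x : Fin n → ℝ) (m : ℕ) :
    gaussianMean n (linForm x ^ (2 * m))
      = (∏ i ∈ Finset.range m, (2 * i + 1 : ℝ)) * eval x (sqNorm n) ^ m := by
  induction m with
  | zero => simp [gaussianMean_one]
  | succ m ih =>
    have h : linForm x ^ (2 * (m + 1)) = ∑ i, x i • (X i * linForm x ^ (2 * m + 1)) := by
      rw [show 2 * (m + 1) = (2 * m + 1) + 1 by ring, pow_succ']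
      nth_rewrite 1 [linForm]
      simp [Finset.sum_mul]
    rw [h, map_sum]
    simp only [map_smul, gaussianMean_X_mul, pderiv_linForm_pow, Nat.add_sub_cancel, ih,
      Finset.prod_range_succ, smul_eq_mul]
    rw [pow_succ (eval x (sqNorm n)), eval_sqNorm, Finset.mul_sum, Finset.mul_sum]
    refine Finset.sum_congr rfl fun i _ => ?_
    push_cast
    ring

/-- X_i - ∂_i is the Gaussian adjoint of ∂_i. By the Hermite recurrence each letter of `p` therefore
moves onto the power of the linear form as a derivative. When `m < p.length` both sides vanish. -/
theorem gaussianMean_mul_hermiteTransform {n : ℕ} (x : Fin n → ℝ) (p : List (Fin n)) (m K : ℕ)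
    (hK : p.length < K) :
    gaussianMean n (linForm x ^ m * hermiteTransform n K (p.map X).prod)
      = m.descFactorial p.length * (p.map x).prod * gaussianMean n (linForm x ^ (m - p.length)) := by
  induction p generalizing m K with
  | nil =>
    obtain ⟨K, rfl⟩ : ∃ K', K = K' + 1 := ⟨K - 1, by simp at hK; omega⟩
    have h1 : (1 : MvPolynomial (Fin n) ℝ).IsHomogeneous 0 := isHomogeneous_one _ _
    simp only [List.map_nil, List.prod_nil]
    rw [hermiteTransform_eq_of_lt h1 (by norm_num : 0 < 2 * 1) (Nat.succ_le_succ K.zero_le)]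
    simp [hermiteTransform_apply]
  | cons i p ih =>
    obtain ⟨K, rfl⟩ : ∃ K', K = K' + 1 := ⟨K - 1, by simp at hK; omega⟩
    simp only [List.length_cons] at hK
    have hh : ((p.map X).prod : MvPolynomial (Fin n) ℝ).IsHomogeneous p.length := by
      clear ih hK
      induction p with
      | nil => exact isHomogeneous_one _ _
      | cons j p ihp =>
        simp only [List.map_cons, List.prod_cons, List.length_cons]
        rw [add_comm]
        exact (isHomogeneous_X ℝ j).mul ihp
    simp only [List.map_cons, List.prod_cons, List.length_cons]
    rw [hermiteTransform_X_mul, hermiteTransform_eq_of_lt hh (K := K) (by omega) (by omega), mul_sub,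
      map_sub, mul_left_comm, gaussianMean_X_mul, Derivation.leibniz, map_add]
    simp only [smul_eq_mul]
    rw [add_sub_cancel_left, pderiv_linForm_pow, mul_smul_comm, map_smul, mul_comm, mul_comm (hermiteTransform _ _ _),
      ih _ _ (by omega)]
    obtain _ | m := m
    · simp
    · rw [Nat.succ_descFactorial_succ]
      simp only [Nat.add_sub_cancel, smul_eq_mul, Nat.add_sub_add_right]
      push_cast
      ring

/-- Integration by parts in each X_i, then Euler's identity ∑ X_i ∂_i f = d f. -/
theorem gaussianMean_sqNorm_mul {n d : ℕ} {f : MvPolynomial (Fin n) ℝ} (hf : f.IsHomogeneous d) :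
    gaussianMean n (sqNorm n * f) = (n + d) * gaussianMean n f := by
  have h : sqNorm n * f = ∑ i, X i * (X i * f) := by
    rw [sqNorm, Finset.sum_mul]
    exact Finset.sum_congr rfl fun i _ => by ring
  have h1 : ∀ i, gaussianMean n (X i * (X i * f))
      = gaussianMean n (X i * pderiv i f) + gaussianMean n f := by
    intro i
    rw [gaussianMean_X_mul, ← map_add]
    simp
  rw [h, map_sum, Finset.sum_congr rfl fun i _ => h1 i, Finset.sum_add_distrib, ← map_sum,
    hf.sum_X_mul_pderiv]
  rw [map_nsmul]
  simp only [nsmul_eq_mul, Finset.sum_const, Finset.card_univ, Fintype.card_fin]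
  ring

theorem isHomogeneous_sqNorm (n : ℕ) : (sqNorm n).IsHomogeneous 2 :=
  IsHomogeneous.sum _ _ _ fun i _ => isHomogeneous_X_pow i 2

/-- The factor is expressed through the total degree `D`, which stays fixed while `k` and the degree
of `f` vary; this is what makes the Hermite transform homogenizable. -/
theorem gaussianMean_sqNorm_pow_mul {n d k D : ℕ} {f : MvPolynomial (Fin n) ℝ}
    (hf : f.IsHomogeneous d) (hD : d + 2 * k = D) :
    gaussianMean n (sqNorm n ^ k * f)
      = (∏ i ∈ Finset.range k, ((n : ℝ) + D - 2 - 2 * i)) * gaussianMean n f := by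
  induction k generalizing d f with
  | zero => simp
  | succ k ih =>
    rw [pow_succ, mul_assoc, ih ((isHomogeneous_sqNorm n).mul hf) (by omega),
      gaussianMean_sqNorm_mul hf, Finset.prod_range_succ, ← hD]
    push_cast
    ring

/-! ### Words, monomials and maximally symmetric matrices as moment functionals. -/

/-- The product of the variables indexed by the letters of a word. -/
noncomputable def wordMonomial {n k : ℕ} (u : Fin k → Fin n) : MvPolynomial (Fin n) ℝ :=
  ∏ i, X (u i)

theorem wordMonomial_eq_monomial {n k : ℕ} (u : Fin k → Fin n) :
    wordMonomial u = monomial (wordExponent u) 1 := by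
  rw [wordExponent, monomial_sum_one]
  rfl

theorem isHomogeneous_wordMonomial {n k : ℕ} (u : Fin k → Fin n) :
    (wordMonomial u).IsHomogeneous k := by
  simpa [wordMonomial] using IsHomogeneous.prod Finset.univ (fun i => (X (u i) : MvPolynomial (Fin n) ℝ))
    (fun _ => 1) fun i _ => isHomogeneous_X ℝ (u i)

theorem eval_wordMonomial {n k : ℕ} (u : Fin k → Fin n) (x : Fin n → ℝ) :
    eval x (wordMonomial u) = ∏ i, x (u i) := by
  simp [wordMonomial]

theorem wordMonomial_mul_eq_monomial {n k m : ℕ} (u : Fin k → Fin n) (v : Fin m → Fin n) :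
    wordMonomial u * wordMonomial v = monomial (wordExponent u + wordExponent v) 1 := by
  rw [wordMonomial_eq_monomial, wordMonomial_eq_monomial, monomial_mul, mul_one]

theorem wordExponent_joinWords {n a l : ℕ} (h : a ≤ l) (u : Fin a → Fin n)
    (w : Fin (l - a) → Fin n) :
    wordExponent (joinWords h u w) = wordExponent u + wordExponent w := by
  unfold wordExponent
  rw [← Equiv.sum_comp (finSumFinEquiv.trans (finCongr (Nat.add_sub_cancel' h))),
    Fintype.sum_sum_type]
  simp [joinWords]

theorem wordMonomial_joinWords {n a l : ℕ} (h : a ≤ l) (u : Fin a → Fin n)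
    (w : Fin (l - a) → Fin n) :
    wordMonomial (joinWords h u w) = wordMonomial u * wordMonomial w := by
  rw [wordMonomial_mul_eq_monomial, wordMonomial_eq_monomial, wordExponent_joinWords]

/-- By `he`, an exponent of degree `d` has as many preimages under `e` as its multinomial
coefficient, which cancels the weight i!/d!. -/
theorem sum_smul_monomial_eq {n d : ℕ} {P : Type*} [Fintype P] (e : P → Fin n →₀ ℕ)
    (he : ∑ p, monomial (e p) (1 : ℝ) = (∑ i, X i) ^ d)
    {T : MvPolynomial (Fin n) ℝ} (hT : T.IsHomogeneous d) :
    ∑ p, (((∏ t : Fin n, Nat.factorial (e p t) : ℕ) : ℝ) / (Nat.factorial d : ℝ)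
      * T.coeff (e p)) • monomial (e p) (1 : ℝ) = T := by
  ext s
  have h1 : ∀ p, coeff s ((((∏ t : Fin n, Nat.factorial (e p t) : ℕ) : ℝ) / (Nat.factorial d : ℝ)
      * T.coeff (e p)) • monomial (e p) (1 : ℝ))
      = (((∏ t : Fin n, Nat.factorial (s t) : ℕ) : ℝ) / (Nat.factorial d : ℝ)
      * T.coeff s) * coeff s (monomial (e p) (1 : ℝ)) := by
    intro p
    rw [coeff_smul, coeff_monomial]
    split_ifs with h
    · rw [h]; rfl
    · simp
  rw [coeff_sum, Finset.sum_congr rfl fun p _ => h1 p, ← Finset.mul_sum, ← coeff_sum, he,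
    coeff_sum_X_pow_of_fintype]
  by_cases hs : s.sum (fun _ m => m) = d
  · rw [if_pos hs]
    have h2 := Nat.multinomial_spec Finset.univ s
    rw [← Finsupp.multinomial_eq_of_support_subset (Finset.subset_univ _)] at h2
    rw [Finsupp.sum_fintype _ _ (by simp)] at hs
    rw [hs] at h2
    rw [← h2]
    have h3 : (Nat.factorial d : ℝ) ≠ 0 := by positivity
    rw [← h2] at h3
    push_cast at h3 ⊢
    field_simp
    exact mul_div_cancel_left₀ _ (right_ne_zero_of_mul h3)
  · rw [if_neg hs, Nat.cast_zero, mul_zero]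
    refine (hT.coeff_eq_zero fun hd => hs ?_).symm
    rw [← hd, Finsupp.degree_eq_sum, Finsupp.sum_fintype _ _ (by simp)]

theorem sum_X_pow_eq_sum_wordMonomial (n k : ℕ) :
    (∑ i, X i : MvPolynomial (Fin n) ℝ) ^ k = ∑ u : Fin k → Fin n, wordMonomial u :=
  Fintype.sum_pow _ k

theorem sum_polynomialMatrix {n a : ℕ} {T : MvPolynomial (Fin n) ℝ}
    (hT : T.IsHomogeneous (2 * a)) :
    ∑ u, ∑ v, polynomialMatrix a T u v • (wordMonomial u * wordMonomial v) = T := by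
  have h := sum_smul_monomial_eq
    (fun p : (Fin a → Fin n) × (Fin a → Fin n) => wordExponent p.1 + wordExponent p.2) (by
      rw [two_mul, pow_add, sum_X_pow_eq_sum_wordMonomial, Finset.sum_mul_sum,
        Fintype.sum_prod_type]
      simp only [wordMonomial_mul_eq_monomial]) hT
  rw [Fintype.sum_prod_type] at h
  simp only [wordMonomial_mul_eq_monomial]
  exact h

theorem gaussianMean_linForm_pow_mul_hermiteTransform {n a : ℕ} {T : MvPolynomial (Fin n) ℝ}
    (hT : T.IsHomogeneous (2 * a)) (x : Fin n → ℝ) (m : ℕ) :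
    gaussianMean n (linForm x ^ m * hermiteTransform n (a + 1) T)
      = m.descFactorial (2 * a) * eval x T * gaussianMean n (linForm x ^ (m - 2 * a)) := by
  -- The list lemma needs truncation order above the word length `2 * a`; the added terms vanish by
  -- degree.
  rw [← hermiteTransform_eq_of_lt hT (by omega : 2 * a < 2 * (a + 1))
    (by omega : a + 1 ≤ 2 * a + 1)]
  have h : ∀ u v : Fin a → Fin n,
      gaussianMean n (linForm x ^ m * hermiteTransform n (2 * a + 1) (wordMonomial u * wordMonomial v))
      = m.descFactorial (2 * a) * eval x (wordMonomial u * wordMonomial v)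
        * gaussianMean n (linForm x ^ (m - 2 * a)) := by
    intro u v
    have h1 := gaussianMean_mul_hermiteTransform x (List.ofFn u ++ List.ofFn v) m (2 * a + 1)
      (by simp; omega)
    have h2 : ((List.ofFn u ++ List.ofFn v).map X).prod
        = (wordMonomial u * wordMonomial v : MvPolynomial (Fin n) ℝ) := by
      simp [List.map_ofFn, List.prod_ofFn, wordMonomial]
    have h3 : ((List.ofFn u ++ List.ofFn v).map x).prod
        = eval x (wordMonomial u * wordMonomial v : MvPolynomial (Fin n) ℝ) := by
      simp [List.map_ofFn, List.prod_ofFn, eval_wordMonomial]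
    rw [h2, h3] at h1
    simpa [← two_mul] using h1
  conv_lhs => rw [← sum_polynomialMatrix hT]
  conv_rhs => rw [← sum_polynomialMatrix hT]
  simp only [map_sum, map_smul, Finset.mul_sum, Finset.sum_mul, mul_smul_comm, h, smul_eval,
    smul_eq_mul]
  refine Finset.sum_congr rfl fun u _ => Finset.sum_congr rfl fun v _ => by ring

/-- Each letter has equally many positions in both words, so bijections between these fibres glue to
a permutation. -/
theorem exists_perm_comp_eq {n : ℕ} {ι : Type*} [Fintype ι] (w w' : ι → Fin n)
    (h : ∑ i, Finsupp.single (w i) 1 = ∑ i, Finsupp.single (w' i) (1 : ℕ)) :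
    ∃ π : Equiv.Perm ι, ∀ i, w' (π i) = w i := by
  classical
  have hc : ∀ t, Nonempty ({i // w i = t} ≃ {i // w' i = t}) := by
    intro t
    have h1 := congrArg (fun s => s t) h
    simp only [Finsupp.finsetSum_apply, Finsupp.single_apply] at h1
    refine ⟨Fintype.equivOfCardEq ?_⟩
    rw [Fintype.card_subtype, Fintype.card_subtype]
    simpa using h1
  exact ⟨Equiv.ofFiberEquiv fun t => Classical.choice (hc t), Equiv.ofFiberEquiv_map _⟩

theorem IsMaxSymmetric.eq_of_wordExponent_eq {n k : ℕ} {N : TensorMatrix n k}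
    (hN : IsMaxSymmetric N) {p q p' q' : Fin k → Fin n}
    (h : wordExponent p + wordExponent q = wordExponent p' + wordExponent q') :
    N p q = N p' q' := by
  obtain ⟨π, hπ⟩ := exists_perm_comp_eq (Sum.elim p q) (Sum.elim p' q') (by
    simpa [wordExponent] using h)
  have h1 := hN π (Sum.elim p' q')
  simp only [hπ] at h1
  simpa [vectorize] using h1

/-- An entry depends only on the total exponent of its two words, so it can be prescribed on the
monomial basis. Exponents that do not occur get the value 0. -/
theorem IsMaxSymmetric.exists_moment {n k : ℕ} {N : TensorMatrix n k} (hN : IsMaxSymmetric N) :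
    ∃ L : MvPolynomial (Fin n) ℝ →ₗ[ℝ] ℝ,
      ∀ p q, L (wordMonomial p * wordMonomial q) = N p q := by
  classical
  set g : (Fin n →₀ ℕ) → ℝ := fun s =>
    if h : ∃ pq : (Fin k → Fin n) × (Fin k → Fin n), wordExponent pq.1 + wordExponent pq.2 = s
    then N h.choose.1 h.choose.2 else 0
  refine ⟨(basisMonomials (Fin n) ℝ).constr ℝ g, fun p q => ?_⟩
  have h : ∃ pq : (Fin k → Fin n) × (Fin k → Fin n),
      wordExponent pq.1 + wordExponent pq.2 = wordExponent p + wordExponent q := ⟨(p, q), rfl⟩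
  have h1 := (basisMonomials (Fin n) ℝ).constr_basis ℝ g (wordExponent p + wordExponent q)
  rw [coe_basisMonomials] at h1
  rw [wordMonomial_mul_eq_monomial, h1]
  exact (dif_pos h).trans (hN.eq_of_wordExponent_eq h.choose_spec)

theorem sqNorm_pow_eq_sum (n m : ℕ) :
    sqNorm n ^ m = ∑ w : Fin m → Fin n, wordMonomial w * wordMonomial w := by
  rw [sqNorm, Fintype.sum_pow]
  refine Finset.sum_congr rfl fun w _ => ?_
  rw [wordMonomial, ← Finset.prod_mul_distrib]
  exact Finset.prod_congr rfl fun i _ => sq _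

/-- Summing the traced-out letters over w produces ∑ x^w x^w = |x|^{2(l-a)}. -/
theorem trace_polynomialMatrix_mul_partialTrace {n a l : ℕ} (h : a ≤ l)
    {T : MvPolynomial (Fin n) ℝ} (hT : T.IsHomogeneous (2 * a)) {N : TensorMatrix n l}
    {L : MvPolynomial (Fin n) ℝ →ₗ[ℝ] ℝ}
    (hL : ∀ p q, L (wordMonomial p * wordMonomial q) = N p q) :
    (polynomialMatrix a T * partialTrace h N).trace = L (sqNorm n ^ (l - a) * T) := by
  have h1 : sqNorm n ^ (l - a) * T = ∑ u, ∑ v, polynomialMatrix a T u v •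
      ∑ w, wordMonomial (joinWords h v w) * wordMonomial (joinWords h u w) := by
    conv_lhs => rw [← sum_polynomialMatrix hT]
    simp only [Finset.mul_sum]
    refine Finset.sum_congr rfl fun u _ => Finset.sum_congr rfl fun v _ => ?_
    rw [mul_smul_comm, sqNorm_pow_eq_sum, Finset.sum_mul]
    congr 1
    refine Finset.sum_congr rfl fun w _ => ?_
    rw [wordMonomial_joinWords, wordMonomial_joinWords]
    ring
  rw [h1]
  simp only [map_sum, map_smul, hL, Matrix.trace, Matrix.diag, Matrix.mul_apply, partialTrace,
    smul_eq_mul]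

/-! ### The Husimi polynomial and the inversion identity. -/

/-- The polynomial `⟨y^{⊗k}, N y^{⊗k}⟩`. -/
noncomputable def husimi {n k : ℕ} (N : TensorMatrix n k) : MvPolynomial (Fin n) ℝ :=
  ∑ p, ∑ q, N p q • (wordMonomial p * wordMonomial q)

theorem isHomogeneous_husimi {n k : ℕ} (N : TensorMatrix n k) :
    (husimi N).IsHomogeneous (2 * k) := by
  refine IsHomogeneous.sum _ _ _ fun p _ => IsHomogeneous.sum _ _ _ fun q _ => ?_
  rw [smul_eq_C_mul, two_mul]
  exact ((isHomogeneous_wordMonomial p).mul (isHomogeneous_wordMonomial q)).C_mul _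

theorem eval_husimi_nonneg {n k : ℕ} {N : TensorMatrix n k} (hN : N.PosSemidef)
    (y : Fin n → ℝ) : 0 ≤ eval y (husimi N) := by
  have h := hN.dotProduct_mulVec_nonneg (fun p => eval y (wordMonomial p))
  refine h.trans_eq ?_
  simp only [husimi, map_sum, smul_eval, map_mul, dotProduct, Matrix.mulVec, Finset.mul_sum,
    Pi.star_apply, star_trivial]
  exact Finset.sum_congr rfl fun p _ => Finset.sum_congr rfl fun q _ => by ring

theorem linForm_pow_eq_sum {n : ℕ} (x : Fin n → ℝ) (k : ℕ) :
    linForm x ^ k = ∑ p : Fin k → Fin n, eval x (wordMonomial p) • wordMonomial p := by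
  rw [linForm, Fintype.sum_pow]
  refine Finset.sum_congr rfl fun p _ => ?_
  rw [eval_wordMonomial, wordMonomial, Finset.prod_smul]

/-- For rank-one data this is the formula for E[⟨x,y⟩^{2l} exp(-Δ/2)T(y)], a multiple of
|x|^{2(l-a)} T(x). Expanding the power in words makes it a polynomial identity in x (`hQ`), to which
the moment functional of `N` applies. -/
theorem gaussianMean_husimi_mul_hermiteTransform {n a l : ℕ} (h : a ≤ l)
    {T : MvPolynomial (Fin n) ℝ} (hT : T.IsHomogeneous (2 * a)) {N : TensorMatrix n l}
    (hN : IsMaxSymmetric N) :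
    gaussianMean n (husimi N * hermiteTransform n (a + 1) T)
      = ((2 * l).descFactorial (2 * a) * ∏ i ∈ Finset.range (l - a), (2 * i + 1 : ℝ))
        * (polynomialMatrix a T * partialTrace h N).trace := by
  obtain ⟨L, hL⟩ := hN.exists_moment
  set H := hermiteTransform n (a + 1) T with hH
  have hQ : ∑ p : Fin l → Fin n, ∑ q : Fin l → Fin n,
      gaussianMean n (wordMonomial p * wordMonomial q * H) • (wordMonomial p * wordMonomial q)
      = ((2 * l).descFactorial (2 * a) * ∏ i ∈ Finset.range (l - a), (2 * i + 1 : ℝ))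
        • (sqNorm n ^ (l - a) * T) := by
    refine MvPolynomial.funext fun x => ?_
    have h1 := gaussianMean_linForm_pow_mul_hermiteTransform hT x (2 * l)
    rw [← Nat.mul_sub, gaussianMean_linForm_pow, ← hH] at h1
    simp only [smul_eval, map_mul, map_pow, map_sum]
    rw [show ∀ A B C D : ℝ, A * B * (C * D) = A * D * (B * C) by intros; ring, ← h1, two_mul,
      pow_add, linForm_pow_eq_sum, Finset.sum_mul_sum, Finset.sum_mul, map_sum]
    refine Finset.sum_congr rfl fun p _ => ?_
    rw [Finset.sum_mul, map_sum]
    refine Finset.sum_congr rfl fun q _ => ?_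
    rw [smul_mul_smul_comm, smul_mul_assoc, map_smul, smul_eq_mul, mul_comm]
  rw [trace_polynomialMatrix_mul_partialTrace h hT hL]
  -- `L` turns each product of word monomials in x into the entry `N p q`, so the left side becomes
  -- the mean against `husimi N`.
  have h2 := congrArg L hQ
  rw [map_smul, smul_eq_mul] at h2
  rw [← h2, husimi]
  simp only [Finset.sum_mul, map_sum, map_smul, smul_mul_assoc, hL, smul_eq_mul]
  refine Finset.sum_congr rfl fun p _ => Finset.sum_congr rfl fun q _ => by ring

/-! ### Banach's theorem on symmetric multilinear forms. -/

/-- Equality in Cauchy–Schwarz: a functional attaining its norm at the unit vector `x` has Riesz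
vector `φ x • x`. -/
theorem map_eq_of_abs_le_of_abs_map_eq {V : Type*} [NormedAddCommGroup V] [InnerProductSpace ℝ V]
    [FiniteDimensional ℝ V] {φ : V →ₗ[ℝ] ℝ} {m : ℝ} {x : V} (hx : ‖x‖ = 1)
    (hφ : ∀ p, ‖p‖ = 1 → |φ p| ≤ m) (hm : |φ x| = m) (p : V) :
    φ p = φ x * inner ℝ x p := by
  have hle : ∀ p, |φ p| ≤ m * ‖p‖ := by
    intro p
    by_cases hp : p = 0
    · simp [hp]
    · have h1 := hφ (‖p‖⁻¹ • p) (by rw [norm_smul, norm_inv, norm_norm]; field_simp)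
      rw [map_smul, smul_eq_mul, abs_mul, abs_inv, abs_norm] at h1
      have : 0 < ‖p‖ := norm_pos_iff.2 hp
      rwa [inv_mul_le_iff₀ this, mul_comm] at h1
  have hm0 : 0 ≤ m := hm ▸ abs_nonneg _
  set g : V := (InnerProductSpace.toDual ℝ V).symm (LinearMap.toContinuousLinearMap φ) with hg
  have hin : ∀ p, inner ℝ g p = φ p := fun p => by
    rw [hg, InnerProductSpace.toDual_symm_apply]; rfl
  have hgm : ‖g‖ ≤ m := by
    rw [hg, LinearIsometryEquiv.norm_map]
    exact ContinuousLinearMap.opNorm_le_bound _ hm0 fun p => hle p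
  have h0 : ‖g - φ x • x‖ ^ 2 ≤ 0 := by
    rw [norm_sub_sq_real, inner_smul_right, hin, norm_smul, hx, Real.norm_eq_abs, hm]
    have h1 : φ x * φ x = m ^ 2 := by rw [← hm, sq_abs, sq]
    have h2 : ‖g‖ ^ 2 ≤ m ^ 2 := pow_le_pow_left₀ (norm_nonneg _) hgm 2
    nlinarith
  have h1 : g = φ x • x := by
    rw [← sub_eq_zero, ← norm_eq_zero]
    exact pow_eq_zero_iff two_ne_zero |>.1 (le_antisymm h0 (sq_nonneg _))
  rw [← hin p, h1, inner_smul_left]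
  simp

theorem norm_sq_add_smul_lt {V : Type*} [NormedAddCommGroup V] [InnerProductSpace ℝ V]
    {s z : V} {c : ℝ} (hc : 0 < c) (h : 0 < inner ℝ s z) : ‖s‖ ^ 2 < ‖s + c • z‖ ^ 2 := by
  rw [norm_add_sq_real, inner_smul_right]
  have := sq_nonneg ‖c • z‖
  nlinarith [mul_pos hc h]

/-- A maximizer of a symmetric bilinear form over pairs of unit vectors can be moved to the
diagonal. -/
theorem abs_bilin_midpoint {V : Type*} [NormedAddCommGroup V] [InnerProductSpace ℝ V]
    [FiniteDimensional ℝ V] {B : V →ₗ[ℝ] V →ₗ[ℝ] ℝ} (hB : ∀ p q, B p q = B q p) {m : ℝ} {x y : V}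
    (hx : ‖x‖ = 1) (hy : ‖y‖ = 1) (hm : ∀ p q, ‖p‖ = 1 → ‖q‖ = 1 → |B p q| ≤ m)
    (hxy : |B x y| = m) (hne : x + y ≠ 0) :
    |B (‖x + y‖⁻¹ • (x + y)) (‖x + y‖⁻¹ • (x + y))| = m := by
  have h1 : B x x = B x y * inner ℝ y x :=
    map_eq_of_abs_le_of_abs_map_eq hy (fun p hp => hm x p hx hp) hxy x
  have h2 : B y y = B y x * inner ℝ x y :=
    map_eq_of_abs_le_of_abs_map_eq hx (fun p hp => hm y p hy hp) (by rw [hB, hxy]) y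
  have h3 : B (x + y) (x + y) = B x y * ‖x + y‖ ^ 2 := by
    rw [norm_add_sq_real, hx, hy]
    simp only [map_add, LinearMap.add_apply, h1, h2]
    rw [hB y x, real_inner_comm x y]
    ring
  have h4 : ‖x + y‖ ≠ 0 := norm_ne_zero_iff.2 hne
  simp only [map_smul, LinearMap.smul_apply, smul_eq_mul, h3]
  rw [← hxy]
  congr 1
  field_simp

theorem sum_update {V ι : Type*} [AddCommGroup V] [Fintype ι] [DecidableEq ι] (v : ι → V) (i : ι)
    (z : V) : ∑ k, Function.update v i z k = ∑ k, v k + (z - v i) := by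
  rw [Finset.sum_update_of_mem (Finset.mem_univ i), ← Finset.add_sum_erase _ v (Finset.mem_univ i),
    Finset.sdiff_singleton_eq_erase]
  abel

/-- **Banach's theorem**: the sup norm of a symmetric multilinear form on a Euclidean space is
attained on the diagonal. -/
theorem abs_le_of_symmetric_of_diagonal {V : Type*} [NormedAddCommGroup V] [InnerProductSpace ℝ V]
    [FiniteDimensional ℝ V] {d : ℕ} (f : MultilinearMap ℝ (fun _ : Fin d => V) ℝ)
    (hcont : Continuous f) (hsymm : ∀ (σ : Equiv.Perm (Fin d)) v, f (v ∘ σ) = f v) {M : ℝ}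
    (hM : ∀ x, ‖x‖ = 1 → |f fun _ => x| ≤ M) {v : Fin d → V} (hv : ∀ i, ‖v i‖ = 1)
    (hd : 0 < d) : |f v| ≤ M := by
  classical
  set K : Set (Fin d → V) := {v | ∀ i, ‖v i‖ = 1} with hK
  have hKc : IsCompact K := by
    have : K = Set.univ.pi fun _ => Metric.sphere (0 : V) 1 := by ext; simp [hK]
    rw [this]
    exact isCompact_univ_pi fun _ => isCompact_sphere 0 1
  obtain ⟨v₀, hv₀, hmax⟩ := hKc.exists_isMaxOn ⟨v, hv⟩ hcont.abs.continuousOn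
  set m := |f v₀| with hm
  have hmax' : ∀ w ∈ K, |f w| ≤ m := fun w hw => hmax hw
  -- Among the tuples maximizing |f|, take one whose sum is longest; it will turn out to be
  -- constant.
  set K' : Set (Fin d → V) := K ∩ {w | |f w| = m}
  have hK'c : IsCompact K' := hKc.inter_right (isClosed_eq hcont.abs continuous_const)
  obtain ⟨w, ⟨hwK, hwm⟩, hwmax⟩ := hK'c.exists_isMaxOn (f := fun w => ‖∑ i, w i‖ ^ 2) ⟨v₀, hv₀, rfl⟩
    (by fun_prop)
  have hwmax' : ∀ u ∈ K, |f u| = m → ‖∑ i, u i‖ ^ 2 ≤ ‖∑ i, w i‖ ^ 2 :=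
    fun u hu hum => hwmax ⟨hu, hum⟩
  have hupd : ∀ u ∈ K, ∀ i z, ‖z‖ = 1 → Function.update u i z ∈ K := by
    intro u hu i z hz j
    by_cases hj : j = i
    · subst hj; simpa using hz
    · simpa [Function.update_of_ne hj] using hu j
  set s := ∑ i, w i with hs
  -- Flipping the sign of `w i` preserves |f|, and ‖s - 2 w_i‖² ≤ ‖s‖² forces ⟨s, w_i⟩ ≥ 1.
  have hpos : ∀ i, 0 < inner ℝ s (w i) := by
    intro i
    have h1 := hwmax' (Function.update w i (-w i)) (hupd w hwK i _ (by rw [norm_neg]; exact hwK i))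
      (by
        rw [show -w i = (-1 : ℝ) • w i by simp, f.map_update_smul, Function.update_eq_self]
        simpa using hwm)
    rw [sum_update, ← hs, show -w i - w i = (-2 : ℝ) • w i by rw [neg_smul, two_smul]; abel,
      norm_add_sq_real, inner_smul_right, norm_smul, hwK i] at h1
    norm_num at h1
    linarith
  have heq : ∀ i j, w i = w j := by
    intro i j
    by_contra hne
    have hij : i ≠ j := fun h => hne (by rw [h])
    have hsum : 0 < inner ℝ s (w i + w j) := by
      rw [inner_add_right]; exact add_pos (hpos i) (hpos j)
    have hne0 : w i + w j ≠ 0 := fun h => by simp [h] at hsum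
    set B : V →ₗ[ℝ] V →ₗ[ℝ] ℝ := LinearMap.mk₂ ℝ
      (fun p q => f (Function.update (Function.update w i p) j q))
      (fun p p' q => by
        rw [Function.update_comm hij, Function.update_comm hij, Function.update_comm hij,
          f.map_update_add])
      (fun c p q => by
        rw [Function.update_comm hij, Function.update_comm hij, f.map_update_smul])
      (fun p q q' => f.map_update_add _ _ _ _) (fun c p q => f.map_update_smul _ _ _ _) with hBdef
    have hB : ∀ p q, B p q = f (Function.update (Function.update w i p) j q) := fun p q => rfl
    have hBsymm : ∀ p q, B p q = B q p := by
      intro p q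
      rw [hB, hB, ← hsymm (Equiv.swap i j)]
      congr 1
      ext k
      simp only [Function.comp_apply]
      by_cases hki : k = i
      · subst hki; simp [Function.update_of_ne hij]
      · by_cases hkj : k = j
        · subst hkj; simp [Function.update_of_ne hij]
        · rw [Equiv.swap_apply_of_ne_of_ne hki hkj]
          simp [Function.update_of_ne hki, Function.update_of_ne hkj]
    have hBw : B (w i) (w j) = f w := by
      rw [hB, Function.update_eq_self, Function.update_eq_self]
    -- Replacing both `w i` and `w j` by their normalized midpoint keeps |f| maximal, but adds to
    -- `s` a positive multiple of `w i + w j` and so lengthens it.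
    set z := ‖w i + w j‖⁻¹ • (w i + w j) with hz
    have hnpos : 0 < ‖w i + w j‖ := norm_pos_iff.2 hne0
    have hz1 : ‖z‖ = 1 := by
      rw [hz, norm_smul, norm_inv, norm_norm, inv_mul_cancel₀ hnpos.ne']
    have hBz : |B z z| = m := abs_bilin_midpoint hBsymm (hwK i) (hwK j)
      (fun p q hp hq => hmax' _ (hupd _ (hupd _ hwK _ _ hp) _ _ hq)) (by rw [hBw]; exact hwm) hne0
    have h1 := hwmax' _ (hupd _ (hupd _ hwK i z hz1) j z hz1) hBz
    rw [sum_update, sum_update, Function.update_of_ne hij.symm, ← hs] at h1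
    have hlt : ‖w i + w j‖ < 2 := by
      have h2 : ‖w i + w j‖ ≤ ‖w i‖ + ‖w j‖ := norm_add_le _ _
      refine lt_of_le_of_ne (by rw [hwK i, hwK j] at h2; linarith) fun h => hne ?_
      have h3 := parallelogram_law_with_norm ℝ (w i) (w j)
      rw [h, hwK i, hwK j] at h3
      have h4 : ‖w i - w j‖ = 0 := by
        have : ‖w i - w j‖ * ‖w i - w j‖ = 0 := by linarith
        exact mul_self_eq_zero.1 this
      exact sub_eq_zero.1 (norm_eq_zero.1 h4)
    have hc : 0 < 2 * ‖w i + w j‖⁻¹ - 1 := by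
      have : 1 < 2 * ‖w i + w j‖⁻¹ := by
        rw [← div_eq_mul_inv, one_lt_div hnpos]; exact hlt
      linarith
    have h2 := norm_sq_add_smul_lt hc hsum
    have h3 : s + (z - w i) + (z - w j) = s + (2 * ‖w i + w j‖⁻¹ - 1) • (w i + w j) := by
      rw [hz]; module
    rw [h3] at h1
    exact absurd h1 (not_le.2 h2)
  have hconst : w = fun _ => w ⟨0, hd⟩ := funext fun i => heq _ _
  calc |f v| ≤ m := hmax' v hv
    _ = |f w| := hwm.symm
    _ ≤ M := by rw [hconst]; exact hM _ (hwK _)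

/-! ### Derivative bounds for forms on the unit sphere. -/

/-- The derivative in the direction `v`, as a linear function of `v`. -/
noncomputable def dirDeriv (n : ℕ) :
    EuclideanSpace ℝ (Fin n) →ₗ[ℝ] Module.End ℝ (MvPolynomial (Fin n) ℝ) where
  toFun v := ∑ i, v i • (pderiv i).toLinearMap
  map_add' v w := by simp [add_smul, Finset.sum_add_distrib]
  map_smul' c v := by simp [mul_smul, Finset.smul_sum]

theorem dirDeriv_apply {n : ℕ} (v : EuclideanSpace ℝ (Fin n)) (f : MvPolynomial (Fin n) ℝ) :
    dirDeriv n v f = ∑ i, v i • pderiv i f := by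
  simp [dirDeriv]

theorem commute_dirDeriv {n : ℕ} (v w : EuclideanSpace ℝ (Fin n)) :
    Commute (dirDeriv n v) (dirDeriv n w) := by
  refine LinearMap.ext fun f => ?_
  simp only [Module.End.mul_apply, dirDeriv_apply, map_sum, Derivation.map_smul]
  rw [Finset.sum_comm]
  refine Finset.sum_congr rfl fun i _ => Finset.sum_congr rfl fun j _ => ?_
  rw [pderiv_pderiv_comm, smul_comm]

theorem MvPolynomial.IsHomogeneous.dirDeriv {n d : ℕ} {f : MvPolynomial (Fin n) ℝ}
    (hf : f.IsHomogeneous d) (v : EuclideanSpace ℝ (Fin n)) :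
    (dirDeriv n v f).IsHomogeneous (d - 1) := by
  rw [dirDeriv_apply]
  refine IsHomogeneous.sum _ _ _ fun i _ => ?_
  rw [smul_eq_C_mul]
  exact hf.pderiv.C_mul _

/-- Euler's identity, iterated. The base point `y` is irrelevant because d derivatives leave a
constant. -/
theorem dirDeriv_pow_self {n d : ℕ} {f : MvPolynomial (Fin n) ℝ} (hf : f.IsHomogeneous d)
    (x : EuclideanSpace ℝ (Fin n)) (y : Fin n → ℝ) :
    eval y ((dirDeriv n x ^ d) f) = d.factorial * eval (fun i => x i) f := by
  induction d generalizing f with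
  | zero =>
    rw [totalDegree_eq_zero_iff_eq_C.1 (Nat.le_zero.1 hf.totalDegree_le)]
    simp
  | succ d ih =>
    rw [pow_succ, Module.End.mul_apply, ih (hf.dirDeriv x), dirDeriv_apply]
    have h := congrArg (eval fun i => x i) hf.sum_X_mul_pderiv
    simp only [map_sum, map_mul, eval_X, nsmul_eq_mul, map_natCast] at h
    simp only [map_sum, smul_eval, h, Nat.factorial_succ]
    push_cast
    ring

/-- The multilinear form `(v₁, …, v_d) ↦ ∂_{v₁} ⋯ ∂_{v_d} f` at the origin. -/
noncomputable def polarForm {n : ℕ} (d : ℕ) (f : MvPolynomial (Fin n) ℝ) :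
    MultilinearMap ℝ (fun _ : Fin d => EuclideanSpace ℝ (Fin n)) ℝ :=
  ((aeval (0 : Fin n → ℝ)).toLinearMap ∘ₗ LinearMap.applyₗ f).compMultilinearMap
    ((MultilinearMap.mkPiAlgebraFin ℝ d (Module.End ℝ (MvPolynomial (Fin n) ℝ))).compLinearMap
      fun _ => dirDeriv n)

theorem polarForm_apply {n d : ℕ} (f : MvPolynomial (Fin n) ℝ)
    (v : Fin d → EuclideanSpace ℝ (Fin n)) :
    polarForm d f v = eval 0 ((List.ofFn fun i => dirDeriv n (v i)).prod f) := by
  simp [polarForm, MultilinearMap.mkPiAlgebraFin_apply, aeval_eq_eval]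

theorem continuous_multilinearMap_euclideanSpace {n d : ℕ}
    (f : MultilinearMap ℝ (fun _ : Fin d => EuclideanSpace ℝ (Fin n)) ℝ) : Continuous f := by
  have h : ∀ v, f v = ∑ r : Fin d → Fin n,
      (∏ j, v j (r j)) * f fun j => EuclideanSpace.single (r j) 1 := by
    intro v
    have h1 : v = fun j => ∑ i, v j i • EuclideanSpace.single i (1 : ℝ) := by
      funext j
      have := (EuclideanSpace.basisFun (Fin n) ℝ).sum_repr (v j)
      simpa using this.symm
    conv_lhs => rw [h1, f.map_sum]
    refine Finset.sum_congr rfl fun r _ => ?_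
    rw [f.map_smul_univ, smul_eq_mul]
  rw [show ⇑f = _ from funext h]
  fun_prop

theorem polarForm_comp_perm {n d : ℕ} (f : MvPolynomial (Fin n) ℝ) (σ : Equiv.Perm (Fin d))
    (v : Fin d → EuclideanSpace ℝ (Fin n)) : polarForm d f (v ∘ σ) = polarForm d f v := by
  rw [polarForm_apply, polarForm_apply]
  congr 2
  refine List.Perm.prod_eq' (Equiv.Perm.ofFn_comp_perm σ fun i => dirDeriv n (v i)) ?_
  refine List.pairwise_of_forall_mem_list fun p hp q hq => ?_
  obtain ⟨i, rfl⟩ := List.mem_ofFn.1 hp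
  obtain ⟨j, rfl⟩ := List.mem_ofFn.1 hq
  exact commute_dirDeriv _ _

/-- `|f| ≤ M` on the unit sphere. -/
def SphereBound {n : ℕ} (f : MvPolynomial (Fin n) ℝ) (M : ℝ) : Prop :=
  ∀ x : EuclideanSpace ℝ (Fin n), ‖x‖ = 1 → |eval (fun i => x i) f| ≤ M

/-- The polar form equals d! f(x) on the diagonal and (d-1)! ∂_i f(x) at (e_i, x, …, x). Banach's
theorem bounds the second value by d! M. -/
theorem SphereBound.pderiv {n d : ℕ} {f : MvPolynomial (Fin n) ℝ} (hf : f.IsHomogeneous d) {M : ℝ}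
    (hM : SphereBound f M) (i : Fin n) : SphereBound (pderiv i f) (d * M) := by
  intro x hx
  obtain _ | d := d
  · simp [pderiv_eq_zero_of_isHomogeneous_zero hf]
  have hpos : (0 : ℝ) < d.factorial := by positivity
  set u : EuclideanSpace ℝ (Fin n) := EuclideanSpace.single i 1
  have h1 := abs_le_of_symmetric_of_diagonal (polarForm (d + 1) f)
    (continuous_multilinearMap_euclideanSpace _) (polarForm_comp_perm f)
    (M := (d + 1).factorial * M) (fun y hy => by
      rw [polarForm_apply, List.ofFn_const, List.prod_replicate, dirDeriv_pow_self hf, abs_mul,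
        Nat.abs_cast]
      exact mul_le_mul_of_nonneg_left (hM y hy) (Nat.cast_nonneg _))
    (v := Fin.cons u fun _ => x) (fun j => by
      refine Fin.cases ?_ (fun j => ?_) j
      · simp [u]
      · simpa using hx) d.succ_pos
  have h2 : dirDeriv n u f = MvPolynomial.pderiv i f := by
    simp [dirDeriv_apply, u]
  rw [polarForm_apply, List.ofFn_succ, List.prod_cons] at h1
  simp only [Fin.cons_zero, Fin.cons_succ, List.ofFn_const, List.prod_replicate] at h1
  rw [((commute_dirDeriv u x).pow_right d).eq, Module.End.mul_apply, h2,
    dirDeriv_pow_self (d := d) (by simpa using hf.pderiv), abs_mul, Nat.abs_cast,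
    Nat.factorial_succ] at h1
  push_cast at h1 ⊢
  rw [mul_comm ((d : ℝ) + 1), mul_assoc] at h1
  exact le_of_mul_le_mul_left h1 hpos

theorem SphereBound.laplacian {n d : ℕ} {f : MvPolynomial (Fin n) ℝ} (hf : f.IsHomogeneous d)
    {M : ℝ} (hM : SphereBound f M) :
    SphereBound (laplacian n f) (n * ((d - 1 : ℕ) * (d * M))) := by
  intro x hx
  rw [laplacian_apply, map_sum]
  refine (Finset.abs_sum_le_sum_abs _ _).trans ?_
  refine (Finset.sum_le_sum fun i _ => (hM.pderiv hf i).pderiv hf.pderiv i x hx).trans ?_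
  simp

theorem SphereBound.laplacian_pow {n d : ℕ} {f : MvPolynomial (Fin n) ℝ} (hf : f.IsHomogeneous d)
    {M : ℝ} (hM : SphereBound f M) (k : ℕ) :
    SphereBound ((_root_.laplacian n ^ k) f) (n ^ k * d.descFactorial (2 * k) * M) := by
  induction k with
  | zero => simpa using hM
  | succ k ih =>
    rw [laplacian_pow_succ_apply]
    convert ih.laplacian (hf.laplacian_pow k) using 1
    rw [show 2 * (k + 1) = 2 * k + 1 + 1 by ring, Nat.descFactorial_succ, Nat.descFactorial_succ,
      ← Nat.sub_sub]
    push_cast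
    ring

/-! ### The homogeneous deconvolution operator and its action on powers of the norm. -/

/-- The descending product that `sqNorm n ^ k` contributes to Gaussian means in total degree
`2 * m`. -/
noncomputable def radialFactor (n m k : ℕ) : ℝ :=
  ∏ i ∈ Finset.range k, ((n : ℝ) + (2 * m : ℕ) - 2 - 2 * i)

/-- The homogeneous polynomial that agrees, against forms of degree `2 * l`, with the Hermite
transform of a form of degree `2 * a`. -/
noncomputable def deconvolution (n a l : ℕ) :
    MvPolynomial (Fin n) ℝ →ₗ[ℝ] MvPolynomial (Fin n) ℝ :=
  ∑ k ∈ Finset.range (a + 1), ((-1) ^ k / (2 ^ k * k.factorial * radialFactor n (l + a) k : ℝ)) •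
    (LinearMap.mulLeft ℝ (sqNorm n ^ k) ∘ₗ laplacian n ^ k)

theorem deconvolution_apply {n : ℕ} (a l : ℕ) (f : MvPolynomial (Fin n) ℝ) :
    deconvolution n a l f = ∑ k ∈ Finset.range (a + 1),
      ((-1) ^ k / (2 ^ k * k.factorial * radialFactor n (l + a) k : ℝ)) •
        (sqNorm n ^ k * (laplacian n ^ k) f) := by
  simp [deconvolution]

theorem pow_le_radialFactor {n a l k : ℕ} (hk : k ≤ a) :
    (2 * (l : ℝ) + n) ^ k ≤ radialFactor n (l + a) k := by
  calc (2 * (l : ℝ) + n) ^ k = ∏ _i ∈ Finset.range k, (2 * (l : ℝ) + n) := by simp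
    _ ≤ radialFactor n (l + a) k := by
      refine Finset.prod_le_prod (fun i _ => by positivity) fun i hi => ?_
      have h : (i : ℝ) + 1 ≤ a := by exact_mod_cast (Finset.mem_range.1 hi).trans_le hk
      push_cast
      linarith

theorem radialFactor_pos {n a l k : ℕ} (hn : 1 ≤ n) (hk : k ≤ a) :
    0 < radialFactor n (l + a) k := by
  refine lt_of_lt_of_le ?_ (pow_le_radialFactor hk)
  have : (1 : ℝ) ≤ n := by exact_mod_cast hn
  positivity

/-- Termwise: in total degree 2(l + a), inserting |y|^{2k} multiplies the mean by exactly the radial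
factor that `deconvolution` divides out. -/
theorem gaussianMean_mul_deconvolution {n a l : ℕ} (hn : 1 ≤ n) {f T : MvPolynomial (Fin n) ℝ}
    (hf : f.IsHomogeneous (2 * l)) (hT : T.IsHomogeneous (2 * a)) :
    gaussianMean n (f * deconvolution n a l T) = gaussianMean n (f * hermiteTransform n (a + 1) T) := by
  rw [deconvolution_apply, hermiteTransform_apply, Finset.mul_sum, Finset.mul_sum, map_sum, map_sum]
  refine Finset.sum_congr rfl fun k hk => ?_
  have hka : k ≤ a := by simpa [Nat.lt_succ_iff] using hk
  have h1 := gaussianMean_sqNorm_pow_mul (k := k) (D := 2 * (l + a))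
    (hf.mul (hT.laplacian_pow k)) (by omega)
  rw [mul_smul_comm, mul_smul_comm, map_smul, map_smul, mul_left_comm, h1, ← radialFactor,
    smul_eq_mul, smul_eq_mul]
  have h2 := (radialFactor_pos (l := l) hn hka).ne'
  have h3 : (k.factorial : ℝ) ≠ 0 := by positivity
  field_simp

theorem laplacian_sqNorm_pow_succ (n m : ℕ) :
    laplacian n (sqNorm n ^ (m + 1)) = (2 * (m + 1) * (2 * m + n) : ℝ) • sqNorm n ^ m := by
  have h0 : ∀ i, pderiv i (sqNorm n) = (2 : ℝ) • X i := by
    intro i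
    have h2 : (C 2 : MvPolynomial (Fin n) ℝ) = 2 := map_ofNat C 2
    simp [sqNorm, Derivation.leibniz_pow, pderiv_X, Pi.single_apply, smul_eq_C_mul, h2]
  have h1 : ∀ (i) (m : ℕ), pderiv i (sqNorm n ^ (m + 1))
      = (2 * (m + 1) : ℝ) • (X i * sqNorm n ^ m) := by
    intro i m
    rw [Derivation.leibniz_pow, h0]
    simp only [Nat.add_sub_cancel, smul_eq_C_mul, smul_eq_mul, nsmul_eq_mul, map_mul, map_add,
      map_natCast, map_one]
    push_cast
    ring
  have h2 : ∀ i, pderiv i (X i * sqNorm n ^ m)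
      = sqNorm n ^ m + (2 * m : ℝ) • (X i ^ 2 * sqNorm n ^ (m - 1)) := by
    intro i
    obtain _ | m := m
    · simp
    · rw [Derivation.leibniz, h1, pderiv_X_self]
      simp only [Nat.add_sub_cancel, smul_eq_C_mul, smul_eq_mul, map_mul, map_add,
        map_natCast, map_one]
      push_cast
      ring
  rw [laplacian_apply]
  simp only [h1, Derivation.map_smul, h2, ← Finset.smul_sum, Finset.sum_add_distrib]
  rw [← Finset.sum_mul, ← sqNorm]
  obtain _ | m := m
  · simp [smul_eq_C_mul]
  · simp only [Nat.add_sub_cancel, smul_eq_C_mul, map_mul, map_add,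
        map_natCast, map_one, Finset.sum_const, Finset.card_univ, Fintype.card_fin, nsmul_eq_mul]
    push_cast
    ring

theorem laplacian_pow_sqNorm_pow {n a k : ℕ} (hk : k ≤ a) :
    (laplacian n ^ k) (sqNorm n ^ a)
      = (∏ i ∈ Finset.range k, (2 * ((a : ℝ) - i) * (2 * (a - i) - 2 + n))) • sqNorm n ^ (a - k) := by
  induction k with
  | zero => simp
  | succ k ih =>
    rw [laplacian_pow_succ_apply, ih (by omega), map_smul,
      show a - k = (a - (k + 1)) + 1 by omega, laplacian_sqNorm_pow_succ, smul_smul,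
      Finset.prod_range_succ, Nat.cast_sub hk]
    congr 2
    push_cast
    ring

/-- The ratio of consecutive terms in the expansion of `deconvolution n a l (sqNorm n ^ a)`. -/
noncomputable def deconvolutionRatio (n a l i : ℕ) : ℝ :=
  ((a : ℝ) - i) * (2 * (a - i) - 2 + n) / ((i + 1) * (n + (2 * (l + a) : ℕ) - 2 - 2 * i))

theorem deconvolution_sqNorm_pow (n a l : ℕ) :
    deconvolution n a l (sqNorm n ^ a)
      = (∑ k ∈ Finset.range (a + 1), (-1) ^ k * ∏ i ∈ Finset.range k, deconvolutionRatio n a l i)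
        • sqNorm n ^ a := by
  rw [deconvolution_apply, Finset.sum_smul]
  refine Finset.sum_congr rfl fun k hk => ?_
  have hka : k ≤ a := by simpa [Nat.lt_succ_iff] using hk
  rw [laplacian_pow_sqNorm_pow hka, mul_smul_comm, ← pow_add, Nat.add_sub_cancel' hka, smul_smul]
  congr 1
  have h1 : (k.factorial : ℝ) = ∏ i ∈ Finset.range k, ((i : ℝ) + 1) := by
    rw [← Finset.prod_range_add_one_eq_factorial]; push_cast; rfl
  simp only [deconvolutionRatio, Finset.prod_div_distrib, Finset.prod_mul_distrib, radialFactor, h1,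
    Finset.prod_const, Finset.card_range]
  field_simp

/-- The sum nests as 1 - r₀(1 - r₁(1 - ⋯)), and every inner bracket lies in [0, 1]. The hypothesis
`h0` is there for `m = 0`. -/
theorem one_sub_le_alternating_sum_prod {m : ℕ} {r : ℕ → ℝ} (h0 : 0 ≤ r 0)
    (hr : ∀ i < m, 0 ≤ r i ∧ r i ≤ 1) :
    1 - r 0 ≤ ∑ k ∈ Finset.range (m + 1), (-1) ^ k * ∏ i ∈ Finset.range k, r i := by
  have step : ∀ (m : ℕ) (r : ℕ → ℝ),
      ∑ k ∈ Finset.range (m + 1 + 1), (-1) ^ k * ∏ i ∈ Finset.range k, r i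
        = 1 - r 0 * ∑ k ∈ Finset.range (m + 1), (-1) ^ k * ∏ i ∈ Finset.range k, r (i + 1) := by
    intro m r
    rw [Finset.sum_range_succ', Finset.mul_sum, sub_eq_add_neg, ← Finset.sum_neg_distrib, add_comm]
    congr 1
    · simp
    · refine Finset.sum_congr rfl fun k _ => ?_
      rw [Finset.prod_range_succ']
      ring
  have key : ∀ (m : ℕ) (r : ℕ → ℝ), (∀ i < m, 0 ≤ r i ∧ r i ≤ 1) →
      ∑ k ∈ Finset.range (m + 1), (-1) ^ k * ∏ i ∈ Finset.range k, r i ∈ Set.Icc 0 1 := by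
    intro m
    induction m with
    | zero => intro r _; simp
    | succ m ih =>
      intro r hr
      obtain ⟨h1, h2⟩ := ih (fun i => r (i + 1)) fun i hi => hr (i + 1) (by omega)
      obtain ⟨h3, h4⟩ := hr 0 (by omega)
      rw [step]
      constructor <;> nlinarith
  obtain _ | m := m
  · simpa using h0
  · rw [step]
    have h1 := (key m (fun i => r (i + 1)) fun i hi => hr (i + 1) (by omega)).2
    nlinarith

/-! ### Numerical estimates in terms of the relaxation error ε. -/

/-- The relative error of the level-`l` relaxation. -/
noncomputable def relaxationError (n a l : ℕ) : ℝ :=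
  4 * (a : ℝ) ^ 2 * ((a : ℝ) + (n : ℝ) / 2 - 1) / (2 * (l : ℝ) + (n : ℝ))

section Estimates

variable {n a l : ℕ}

theorem relaxationError_nonneg (ha : 1 ≤ a) : 0 ≤ relaxationError n a l := by
  have ha' : (1 : ℝ) ≤ a := by exact_mod_cast ha
  refine div_nonneg (mul_nonneg (by positivity) ?_) (by positivity)
  have : (0 : ℝ) ≤ n := Nat.cast_nonneg n
  linarith

/-- The numerator is at most its value a(2a - 2 + n) at `i = 0`, the denominator is at least 2l + n,
and the quotient of these is ε/(2a). -/
theorem deconvolutionRatio_mem (hn : 1 ≤ n) {i : ℕ} (hi : i < a) :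
    0 ≤ deconvolutionRatio n a l i ∧
      deconvolutionRatio n a l i ≤ relaxationError n a l / (2 * a) := by
  have hn' : (1 : ℝ) ≤ n := by exact_mod_cast hn
  have hi' : (i : ℝ) + 1 ≤ a := by exact_mod_cast hi
  have hi0 : (0 : ℝ) ≤ i := Nat.cast_nonneg i
  have hl0 : (0 : ℝ) ≤ l := Nat.cast_nonneg l
  have ha : (0 : ℝ) < a := by linarith
  have hQ : 2 * (l : ℝ) + n ≤ (i + 1) * (n + (2 * (l + a) : ℕ) - 2 - 2 * i) := by
    push_cast
    nlinarith
  have hQ0 : (0 : ℝ) < 2 * l + n := by linarith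
  have h1 : relaxationError n a l / (2 * a) = a * (2 * a - 2 + n) / (2 * l + n) := by
    rw [relaxationError]
    field_simp
    ring
  rw [h1, deconvolutionRatio]
  constructor
  · exact div_nonneg (mul_nonneg (by linarith) (by linarith)) (by linarith)
  · exact div_le_div₀ (mul_nonneg ha.le (by linarith))
      (mul_le_mul (by linarith) (by linarith) (by linarith) ha.le) hQ0 hQ

theorem one_sub_le_sum_deconvolutionRatio (hn : 1 ≤ n) (ha : 1 ≤ a)
    (hε : relaxationError n a l ≤ 1) :
    1 - relaxationError n a l / (2 * a) ≤
      ∑ k ∈ Finset.range (a + 1), (-1) ^ k * ∏ i ∈ Finset.range k, deconvolutionRatio n a l i := by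
  have ha' : (1 : ℝ) ≤ a := by exact_mod_cast ha
  have h1 : relaxationError n a l / (2 * a) ≤ 1 := by
    rw [div_le_one (by positivity)]; linarith
  obtain ⟨h2, h3⟩ := deconvolutionRatio_mem (l := l) hn (show 0 < a from ha)
  refine le_trans (by linarith) (one_sub_le_alternating_sum_prod h2 fun i hi => ?_)
  exact ⟨(deconvolutionRatio_mem hn hi).1, (deconvolutionRatio_mem hn hi).2.trans h1⟩

/-- With A = a + 1, the third factor of the falling factorial is 2A - 2 = 2A(1 - 1/A). This saving
of 1 - 1/A is needed in the terms of order at least two. -/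
theorem descFactorial_two_mul_le (a j : ℕ) :
    (a + 1) * (2 * (a + 1)).descFactorial (2 * (j + 2)) ≤ a * (2 * (a + 1)) ^ (2 * (j + 2)) := by
  rw [show 2 * (a + 1) = 2 * a + 1 + 1 by ring, show 2 * (j + 2) = 2 * j + 2 + 1 + 1 by ring,
    Nat.succ_descFactorial_succ, Nat.succ_descFactorial_succ]
  have h1 : (2 * a).descFactorial (2 * j + 2) ≤ (2 * a) * (2 * a + 1 + 1) ^ (2 * j + 1) :=
    (Nat.descFactorial_le_pow _ _).trans (by
      rw [pow_succ']
      exact Nat.mul_le_mul_left _ (Nat.pow_le_pow_left (by omega) _))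
  calc (a + 1) * ((2 * a + 1 + 1) * ((2 * a + 1) * (2 * a).descFactorial (2 * j + 2)))
      ≤ (a + 1) * ((2 * a + 1 + 1) * ((2 * a + 1 + 1) *
        ((2 * a) * (2 * a + 1 + 1) ^ (2 * j + 1)))) := by gcongr; omega
    _ = a * (2 * a + 1 + 1) ^ (2 * j + 2 + 1 + 1) := by ring

/-- The bound for the `k`-th term of `deconvolution n a l f` on the unit sphere, for `|f| ≤ 1`. -/
noncomputable def deconvolutionBound (n a l k : ℕ) : ℝ :=
  n ^ k * (2 * a).descFactorial (2 * k) / (2 ^ k * k.factorial * radialFactor n (l + a) k)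

theorem deconvolutionBound_le (hn : 1 ≤ n) {k : ℕ} (hk : k ≤ a) :
    deconvolutionBound n a l k ≤
      n ^ k * (2 * a).descFactorial (2 * k) / (2 ^ k * k.factorial * (2 * l + n) ^ k) := by
  have hn' : (1 : ℝ) ≤ n := by exact_mod_cast hn
  unfold deconvolutionBound
  gcongr
  exact pow_le_radialFactor hk

theorem deconvolutionBound_one_le (hn : 1 ≤ n) (ha : 1 ≤ a) :
    deconvolutionBound n a l 1 ≤ relaxationError n a l * (1 - 1 / (2 * a)) := by
  have hn' : (1 : ℝ) ≤ n := by exact_mod_cast hn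
  have ha' : (1 : ℝ) ≤ a := by exact_mod_cast ha
  refine (deconvolutionBound_le hn ha).trans ?_
  obtain ⟨b, rfl⟩ : ∃ b, a = b + 1 := ⟨a - 1, by omega⟩
  have h1 : ((2 * (b + 1)).descFactorial (2 * 1) : ℝ) = (2 * b + 2) * (2 * b + 1) := by
    rw [show 2 * (b + 1) = 2 * b + 1 + 1 by ring]
    simp only [Nat.succ_descFactorial_succ, Nat.descFactorial_zero, mul_one]
    push_cast
    ring
  have hQ0 : (0 : ℝ) < 2 * l + n := by positivity
  rw [h1, relaxationError]
  push_cast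
  rw [show (1 : ℝ) - 1 / (2 * (b + 1)) = (2 * b + 1) / (2 * (b + 1)) by field_simp; ring]
  rw [div_mul_div_comm, div_le_div_iff₀ (by simp; positivity) (by positivity)]
  simp only [pow_one, Nat.factorial_one, Nat.cast_one]
  have hb : (0 : ℝ) ≤ b := Nat.cast_nonneg b
  have : 0 ≤ (2 * (l : ℝ) + n) * ((2 * b + 1) * (b + 1) ^ 2 * b) := by positivity
  nlinarith

theorem deconvolutionBound_add_two_le (hn : 1 ≤ n) (ha : 1 ≤ a) {k : ℕ} (hk : k + 2 ≤ a) :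
    deconvolutionBound n a l (k + 2) ≤
      (1 - 1 / a) * (relaxationError n a l ^ (k + 2) / (k + 2).factorial) := by
  have hn' : (1 : ℝ) ≤ n := by exact_mod_cast hn
  have ha' : (1 : ℝ) ≤ a := by exact_mod_cast ha
  refine (deconvolutionBound_le hn hk).trans ?_
  have hQ0 : (0 : ℝ) < 2 * l + n := by positivity
  have h1 : ((2 * a).descFactorial (2 * (k + 2)) : ℝ) ≤ (1 - 1 / a) * (2 * a) ^ (2 * (k + 2)) := by
    obtain ⟨b, rfl⟩ : ∃ b, a = b + 1 := ⟨a - 1, by omega⟩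
    have h2 : (((b + 1) * (2 * (b + 1)).descFactorial (2 * (k + 2)) : ℕ) : ℝ)
      ≤ ((b * (2 * (b + 1)) ^ (2 * (k + 2)) : ℕ) : ℝ) := by exact_mod_cast descFactorial_two_mul_le b k
    push_cast at h2 ⊢
    rw [show (1 : ℝ) - 1 / (b + 1) = b / (b + 1) by field_simp; ring, div_mul_eq_mul_div,
      le_div_iff₀ (by positivity), mul_comm]
    exact h2
  have h3 : (n : ℝ) * (2 * a) ^ 2 / (2 * (2 * l + n)) ≤ relaxationError n a l := by
    rw [relaxationError, div_le_div_iff₀ (by positivity) hQ0]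
    have : 0 ≤ (2 * (l : ℝ) + n) * (a ^ 2 * (a - 1)) :=
      mul_nonneg hQ0.le (mul_nonneg (by positivity) (by linarith))
    nlinarith
  have h4 : (0 : ℝ) ≤ 1 - 1 / a := by
    rw [sub_nonneg, div_le_one (by positivity)]; exact ha'
  calc (n : ℝ) ^ (k + 2) * (2 * a).descFactorial (2 * (k + 2))
        / (2 ^ (k + 2) * (k + 2).factorial * (2 * l + n) ^ (k + 2))
      ≤ n ^ (k + 2) * ((1 - 1 / a) * (2 * a) ^ (2 * (k + 2)))
        / (2 ^ (k + 2) * (k + 2).factorial * (2 * l + n) ^ (k + 2)) := by gcongr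
    _ = (1 - 1 / a) * ((n * (2 * a) ^ 2 / (2 * (2 * l + n))) ^ (k + 2) / (k + 2).factorial) := by
      rw [div_pow, mul_pow (n : ℝ), mul_pow 2 (2 * (l : ℝ) + n), ← pow_mul]
      field_simp
    _ ≤ _ := by gcongr

/-- The first term is estimated separately; the others are dominated by the exponential series,
whose tail satisfies e^ε - 1 - ε ≤ ε² for 0 ≤ ε ≤ 1. -/
theorem sum_deconvolutionBound_le (hn : 1 ≤ n) (ha : 1 ≤ a) (hε : relaxationError n a l ≤ 1) :
    ∑ k ∈ Finset.range a, deconvolutionBound n a l (k + 1) ≤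
      relaxationError n a l * (1 - 1 / (2 * a)) + (1 - 1 / a) * relaxationError n a l ^ 2 := by
  have ha' : (1 : ℝ) ≤ a := by exact_mod_cast ha
  have h4 : (0 : ℝ) ≤ 1 - 1 / a := by
    rw [sub_nonneg, div_le_one (by positivity)]; exact ha'
  have hε0 := relaxationError_nonneg (n := n) (l := l) ha
  obtain ⟨b, rfl⟩ : ∃ b, a = b + 1 := ⟨a - 1, by omega⟩
  set ε := relaxationError n (b + 1) l
  rw [Finset.sum_range_succ', add_comm]
  refine add_le_add (deconvolutionBound_one_le hn ha) ?_
  calc ∑ k ∈ Finset.range b, deconvolutionBound n (b + 1) l (k + 1 + 1)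
      ≤ ∑ k ∈ Finset.range b, (1 - 1 / ((b + 1 : ℕ) : ℝ)) * (ε ^ (k + 2) / (k + 2).factorial) :=
        Finset.sum_le_sum fun k hk =>
          deconvolutionBound_add_two_le hn ha (by have := Finset.mem_range.1 hk; omega)
    _ = (1 - 1 / ((b + 1 : ℕ) : ℝ)) * ∑ k ∈ Finset.range b, ε ^ (k + 2) / (k + 2).factorial := by
        rw [Finset.mul_sum]
    _ ≤ (1 - 1 / ((b + 1 : ℕ) : ℝ)) * ε ^ 2 := by
        refine mul_le_mul_of_nonneg_left ?_ h4
        have h5 := Real.sum_le_exp_of_nonneg hε0 (b + 2)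
        rw [Finset.sum_range_succ', Finset.sum_range_succ'] at h5
        have h6 := (abs_le.1 (Real.abs_exp_sub_one_sub_id_le (x := ε) (by rwa [abs_of_nonneg hε0]))).2
        simp only [zero_add, pow_one, pow_zero, Nat.factorial_one, Nat.factorial_zero, Nat.cast_one,
          div_one] at h5
        linarith

/-- After inserting both estimates, all terms containing 1/a cancel and the slack is exactly ε(1 -
ε). -/
theorem one_add_sum_deconvolutionBound_le (hn : 1 ≤ n) (ha : 1 ≤ a)
    (hε : relaxationError n a l ≤ 1) :
    1 + ∑ k ∈ Finset.range a, deconvolutionBound n a l (k + 1) ≤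
      (1 + 2 * relaxationError n a l) *
      ∑ k ∈ Finset.range (a + 1), (-1) ^ k * ∏ i ∈ Finset.range k, deconvolutionRatio n a l i := by
  have ha' : (1 : ℝ) ≤ a := by exact_mod_cast ha
  have hε0 := relaxationError_nonneg (n := n) (l := l) ha
  have h1 := sum_deconvolutionBound_le hn ha hε
  have h2 := mul_le_mul_of_nonneg_left (one_sub_le_sum_deconvolutionRatio hn ha hε)
    (by linarith : 0 ≤ 1 + 2 * relaxationError n a l)
  set ε := relaxationError n a l
  have h3 : (1 + 2 * ε) * (1 - ε / (2 * a)) - 1 - (ε * (1 - 1 / (2 * a)) + (1 - 1 / a) * ε ^ 2)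
      = ε * (1 - ε) := by
    field_simp
    ring
  have h4 : 0 ≤ ε * (1 - ε) := mul_nonneg hε0 (by linarith)
  linarith

end Estimates

/-! ### Nonnegativity of the deconvolved form and the upper bound. -/

theorem MvPolynomial.IsHomogeneous.eval_smul {n d : ℕ} {f : MvPolynomial (Fin n) ℝ}
    (hf : f.IsHomogeneous d) (c : ℝ) (x : Fin n → ℝ) : eval (c • x) f = c ^ d * eval x f := by
  rw [eval_eq', eval_eq', Finset.mul_sum]
  refine Finset.sum_congr rfl fun s hs => ?_
  have h1 : s.degree = d := by
    by_contra h
    exact mem_support_iff.1 hs (hf.coeff_eq_zero h)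
  simp only [Pi.smul_apply, smul_eq_mul, mul_pow, Finset.prod_mul_distrib, Finset.prod_pow_eq_pow_sum]
  rw [← Finsupp.degree_eq_sum, h1]
  ring

theorem MvPolynomial.IsHomogeneous.eval_nonneg {n d : ℕ} (hn : 1 ≤ n) {f : MvPolynomial (Fin n) ℝ}
    (hf : f.IsHomogeneous d)
    (h : ∀ x : EuclideanSpace ℝ (Fin n), ‖x‖ = 1 → 0 ≤ eval (fun i => x i) f) (y : Fin n → ℝ) :
    0 ≤ eval y f := by
  have hex : ∃ x : EuclideanSpace ℝ (Fin n), ‖x‖ = 1 ∧ ∃ c : ℝ, 0 ≤ c ∧ y = c • fun i => x i := by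
    by_cases hy : y = 0
    · exact ⟨EuclideanSpace.single ⟨0, hn⟩ 1, by simp, 0, le_rfl, by simp [hy]⟩
    · set z : EuclideanSpace ℝ (Fin n) := WithLp.toLp 2 y
      have hz : z ≠ 0 := fun h0 => hy (by simpa [z] using h0)
      have hz' : ‖z‖ ≠ 0 := norm_ne_zero_iff.2 hz
      refine ⟨‖z‖⁻¹ • z, ?_, ‖z‖, norm_nonneg _, ?_⟩
      · rw [norm_smul, norm_inv, norm_norm, inv_mul_cancel₀ hz']
      · funext i
        simp only [Pi.smul_apply, PiLp.smul_apply, smul_eq_mul]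
        rw [mul_inv_cancel_left₀ hz']
  obtain ⟨x, hx, c, hc, rfl⟩ := hex
  rw [hf.eval_smul]
  exact mul_nonneg (pow_nonneg hc d) (h x hx)

theorem eval_sqNorm_of_norm_eq_one {n : ℕ} {x : EuclideanSpace ℝ (Fin n)} (hx : ‖x‖ = 1) :
    eval (fun i => x i) (sqNorm n) = 1 := by
  rw [eval_sqNorm, ← EuclideanSpace.real_norm_sq_eq, hx, one_pow]

theorem isHomogeneous_deconvolution {n a l : ℕ} {f : MvPolynomial (Fin n) ℝ}
    (hf : f.IsHomogeneous (2 * a)) : (deconvolution n a l f).IsHomogeneous (2 * a) := by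
  rw [deconvolution_apply]
  refine IsHomogeneous.sum _ _ _ fun k hk => ?_
  have hka : k ≤ a := by simpa [Nat.lt_succ_iff] using hk
  rw [smul_eq_C_mul]
  refine IsHomogeneous.C_mul ?_ _
  have h := ((isHomogeneous_sqNorm n).pow k).mul (hf.laplacian_pow k)
  rwa [Nat.add_sub_cancel' (by omega)] at h

theorem SphereBound.deconvolution {n a l : ℕ} (hn : 1 ≤ n) {f : MvPolynomial (Fin n) ℝ}
    (hf : f.IsHomogeneous (2 * a)) {M : ℝ} (hM : SphereBound f M) :
    SphereBound (deconvolution n a l f)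
      ((1 + ∑ k ∈ Finset.range a, deconvolutionBound n a l (k + 1)) * M) := by
  intro x hx
  have h0 : deconvolutionBound n a l 0 = 1 := by simp [deconvolutionBound, radialFactor]
  rw [add_comm, ← h0, ← Finset.sum_range_succ', Finset.sum_mul, deconvolution_apply, map_sum]
  refine (Finset.abs_sum_le_sum_abs _ _).trans (Finset.sum_le_sum fun k hk => ?_)
  have hka : k ≤ a := by simpa [Nat.lt_succ_iff] using hk
  have h1 := hM.laplacian_pow hf k x hx
  have h2 := radialFactor_pos (l := l) hn hka
  rw [smul_eval, map_mul, map_pow, eval_sqNorm_of_norm_eq_one hx, one_pow, one_mul, abs_mul, abs_div,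
    abs_pow, abs_neg, abs_one, one_pow, abs_of_pos (by positivity), deconvolutionBound, one_div,
    div_mul_eq_mul_div, div_eq_inv_mul]
  exact mul_le_mul_of_nonneg_left h1 (by positivity)

/-- A form `T` with `0 ≤ ν - T ≤ R` on the sphere: shifting by `ε R` makes the deconvolution
of `ν - T` nonnegative. -/
theorem eval_deconvolution_nonneg {n a l : ℕ} (hn : 1 ≤ n) (ha : 1 ≤ a)
    (hε : relaxationError n a l ≤ 1) {T : MvPolynomial (Fin n) ℝ} (hT : T.IsHomogeneous (2 * a))
    {ν μ : ℝ} (hν : ∀ x : EuclideanSpace ℝ (Fin n), ‖x‖ = 1 → eval (fun i => x i) T ≤ ν)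
    (hμ : ∀ x : EuclideanSpace ℝ (Fin n), ‖x‖ = 1 → μ ≤ eval (fun i => x i) T) (hμν : μ ≤ ν)
    (y : Fin n → ℝ) :
    0 ≤ eval y (deconvolution n a l
      ((ν + relaxationError n a l * (ν - μ)) • sqNorm n ^ a - T)) := by
  have hr : (sqNorm n ^ a).IsHomogeneous (2 * a) := (isHomogeneous_sqNorm n).pow a
  have hsm : ∀ c : ℝ, (c • sqNorm n ^ a).IsHomogeneous (2 * a) := fun c => by
    rw [smul_eq_C_mul]; exact hr.C_mul c
  refine (isHomogeneous_deconvolution ((hsm _).sub hT)).eval_nonneg hn (fun x hx => ?_) y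
  set ε := relaxationError n a l
  -- Centring at the midpoint of the range of `T` makes the sup norm on the sphere only (ν - μ)/2.
  set H := ((ν + μ) / 2) • sqNorm n ^ a - T with hH
  have hHb : SphereBound H ((ν - μ) / 2) := by
    intro z hz
    have h1 := hν z hz
    have h2 := hμ z hz
    rw [hH, map_sub, smul_eval, map_pow, eval_sqNorm_of_norm_eq_one hz, one_pow, abs_le]
    constructor <;> linarith
  have h1 := (abs_le.1 (hHb.deconvolution (l := l) hn ((hsm _).sub hT) x hx)).1
  have h2 : (ν + ε * (ν - μ)) • sqNorm n ^ a - T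
      = H + ((1 + 2 * ε) * ((ν - μ) / 2)) • sqNorm n ^ a := by
    rw [hH]; module
  rw [h2, map_add, map_smul, deconvolution_sqNorm_pow, map_add, smul_eval, smul_eval, map_pow,
    eval_sqNorm_of_norm_eq_one hx, one_pow, mul_one]
  have h3 := mul_le_mul_of_nonneg_right (one_add_sum_deconvolutionBound_le hn ha hε)
    (by linarith : 0 ≤ (ν - μ) / 2)
  linarith

/-- The inversion identity, applied to c|y|^{2a} - T, expresses a positive multiple of c - tr(Z_T M)
as a Gaussian mean of a product of two nonnegative polynomials. -/
theorem trace_polynomialMatrix_mul_partialTrace_le {n a l : ℕ} (hn : 1 ≤ n) (ha : 1 ≤ a)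
    (hal : a ≤ l) (hε : relaxationError n a l ≤ 1) {T : MvPolynomial (Fin n) ℝ}
    (hT : T.IsHomogeneous (2 * a)) {ν μ : ℝ}
    (hν : ∀ x : EuclideanSpace ℝ (Fin n), ‖x‖ = 1 → eval (fun i => x i) T ≤ ν)
    (hμ : ∀ x : EuclideanSpace ℝ (Fin n), ‖x‖ = 1 → μ ≤ eval (fun i => x i) T) (hμν : μ ≤ ν)
    {N : TensorMatrix n l} (hN : IsMaxSymmetric N) (hpos : N.PosSemidef) (htr : N.trace = 1) :
    (polynomialMatrix a T * partialTrace hal N).trace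
      ≤ ν + relaxationError n a l * (ν - μ) := by
  set c := ν + relaxationError n a l * (ν - μ) with hc
  have hF : (c • sqNorm n ^ a - T).IsHomogeneous (2 * a) := by
    refine IsHomogeneous.sub ?_ hT
    rw [smul_eq_C_mul]
    exact ((isHomogeneous_sqNorm n).pow a).C_mul c
  have h1 := gaussianMean_husimi_mul_hermiteTransform hal hF hN
  rw [← gaussianMean_mul_deconvolution hn (isHomogeneous_husimi N) hF] at h1
  have h2 : 0 ≤ gaussianMean n (husimi N * deconvolution n a l (c • sqNorm n ^ a - T)) :=
    gaussianMean_nonneg fun y => by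
      rw [map_mul]
      exact mul_nonneg (eval_husimi_nonneg hpos y)
        (eval_deconvolution_nonneg hn ha hε hT hν hμ hμν y)
  rw [h1] at h2
  have h3 : (0 : ℝ) < (2 * l).descFactorial (2 * a) *
      ∏ i ∈ Finset.range (l - a), (2 * i + 1 : ℝ) := by
    have : 0 < (2 * l).descFactorial (2 * a) := Nat.descFactorial_pos.2 (by omega)
    have h4 : (0 : ℝ) < (2 * l).descFactorial (2 * a) := by exact_mod_cast this
    exact mul_pos h4 (Finset.prod_pos fun i _ => by positivity)
  have h5 := nonneg_of_mul_nonneg_right h2 h3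
  obtain ⟨L, hL⟩ := hN.exists_moment
  rw [trace_polynomialMatrix_mul_partialTrace hal hF hL, mul_sub, mul_smul_comm, ← pow_add,
    Nat.sub_add_cancel hal, map_sub, map_smul,
    ← trace_polynomialMatrix_mul_partialTrace hal hT hL] at h5
  have h6 : L (sqNorm n ^ l) = 1 := by
    rw [sqNorm_pow_eq_sum, map_sum, ← htr, Matrix.trace]
    exact Finset.sum_congr rfl fun w _ => hL w w
  rw [h6, smul_eq_mul, mul_one] at h5
  linarith

/-! ### Pure states: the relaxation dominates the sphere values. -/

/-- The pure state `(y yᵀ)^{⊗k}`. -/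
noncomputable def pureTensorMatrix {n : ℕ} (k : ℕ) (y : Fin n → ℝ) : TensorMatrix n k :=
  fun p q => eval y (wordMonomial p) * eval y (wordMonomial q)

theorem isMaxSymmetric_pureTensorMatrix {n : ℕ} (k : ℕ) (y : Fin n → ℝ) :
    IsMaxSymmetric (pureTensorMatrix k y) := by
  have h : ∀ w, vectorize (pureTensorMatrix k y) w = ∏ i, y (w i) := by
    intro w
    simp [vectorize, pureTensorMatrix, eval_wordMonomial, Fintype.prod_sum_type]
  intro π w
  rw [h, h]
  exact Equiv.prod_comp π fun i => y (w i)

theorem posSemidef_pureTensorMatrix {n : ℕ} (k : ℕ) (y : Fin n → ℝ) :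
    (pureTensorMatrix k y).PosSemidef := by
  have h := Matrix.posSemidef_vecMulVec_self_star fun p : Fin k → Fin n => eval y (wordMonomial p)
  rwa [star_trivial] at h

theorem sum_eval_wordMonomial_sq {n : ℕ} (k : ℕ) {y : Fin n → ℝ} (hy : eval y (sqNorm n) = 1) :
    ∑ w : Fin k → Fin n, eval y (wordMonomial w) * eval y (wordMonomial w) = 1 := by
  have h := congrArg (eval y) (sqNorm_pow_eq_sum n k)
  simpa [hy] using h.symm

theorem partialTrace_pureTensorMatrix {n a l : ℕ} (h : a ≤ l) {y : Fin n → ℝ}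
    (hy : eval y (sqNorm n) = 1) :
    partialTrace h (pureTensorMatrix l y) = pureTensorMatrix a y := by
  funext u v
  simp only [partialTrace, pureTensorMatrix, wordMonomial_joinWords, map_mul]
  rw [← mul_one (eval y (wordMonomial u) * eval y (wordMonomial v)),
    ← sum_eval_wordMonomial_sq (l - a) hy, Finset.mul_sum]
  exact Finset.sum_congr rfl fun w _ => by ring

theorem pureTensorMatrix_mem_relaxedMomentMatrices {n a l : ℕ} (h : a ≤ l) {y : Fin n → ℝ}
    (hy : eval y (sqNorm n) = 1) : pureTensorMatrix a y ∈ relaxedMomentMatrices n a l :=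
  ⟨isMaxSymmetric_pureTensorMatrix a y, h, pureTensorMatrix l y, isMaxSymmetric_pureTensorMatrix l y,
    posSemidef_pureTensorMatrix l y, sum_eval_wordMonomial_sq l hy,
    partialTrace_pureTensorMatrix h hy⟩

theorem trace_polynomialMatrix_mul_pureTensorMatrix {n a : ℕ} {T : MvPolynomial (Fin n) ℝ}
    (hT : T.IsHomogeneous (2 * a)) (y : Fin n → ℝ) :
    (polynomialMatrix a T * pureTensorMatrix a y).trace = eval y T := by
  conv_rhs => rw [← sum_polynomialMatrix hT]
  simp only [map_sum, smul_eval, map_mul, Matrix.trace, Matrix.diag, Matrix.mul_apply,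
    pureTensorMatrix]
  exact Finset.sum_congr rfl fun u _ => Finset.sum_congr rfl fun v _ => by ring

/-! ### Compactness of the feasible set, for attainment. -/

theorem isClosed_isMaxSymmetric (n k : ℕ) : IsClosed {N : TensorMatrix n k | IsMaxSymmetric N} := by
  simp only [IsMaxSymmetric, Set.ofPred_forall]
  refine isClosed_iInter fun π => isClosed_iInter fun w => isClosed_eq ?_ ?_ <;>
  · unfold vectorize
    fun_prop

theorem isClosed_posSemidef (ι : Type*) [Fintype ι] :
    IsClosed {N : Matrix ι ι ℝ | N.PosSemidef} := by
  simp only [Matrix.posSemidef_iff_dotProduct_mulVec, Set.ofPred_and, Set.ofPred_forall]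
  refine IsClosed.inter (isClosed_eq (by fun_prop) continuous_id) (isClosed_iInter fun x => ?_)
  exact isClosed_le continuous_const (by fun_prop)

/-- Testing on e_p ± e_q gives 2|N_pq| ≤ N_pp + N_qq ≤ 2 tr N. -/
theorem Matrix.PosSemidef.abs_apply_le_trace {ι : Type*} [Fintype ι] {N : Matrix ι ι ℝ}
    (hN : N.PosSemidef) (p q : ι) : |N p q| ≤ N.trace := by
  classical
  have hd : ∀ p, N p p ≤ N.trace := fun p =>
    Finset.single_le_sum (f := fun i => N i i) (fun i _ => hN.diag_nonneg) (Finset.mem_univ p)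
  have hs : N q p = N p q := by simpa using hN.1.apply p q
  have h : ∀ t : ℝ, 0 ≤ N p p + 2 * t * N p q + t ^ 2 * N q q := by
    intro t
    have h1 := hN.dotProduct_mulVec_nonneg (Pi.single p 1 + t • Pi.single q 1)
    simp only [star_trivial, Matrix.mulVec_add, Matrix.mulVec_smul, dotProduct_add, add_dotProduct,
      smul_dotProduct, dotProduct_smul, Matrix.mulVec_single_one, single_one_dotProduct,
      Matrix.col_apply, smul_eq_mul, hs] at h1
    linarith
  have h1 := h 1
  have h2 := h (-1)
  have h3 := hd p
  have h4 := hd q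
  rw [abs_le]
  constructor <;> linarith

theorem isCompact_maxSymmetric_states (n k : ℕ) :
    IsCompact {N : TensorMatrix n k | IsMaxSymmetric N ∧ N.PosSemidef ∧ N.trace = 1} := by
  have hbox : IsCompact (Set.univ.pi fun _ => Set.univ.pi fun _ => Set.Icc (-1) 1 :
      Set (TensorMatrix n k)) :=
    isCompact_univ_pi fun _ => isCompact_univ_pi fun _ => isCompact_Icc
  refine hbox.of_isClosed_subset ?_ fun N hN p _ q _ => ?_
  · exact (isClosed_isMaxSymmetric n k).inter ((isClosed_posSemidef _).inter
      (isClosed_eq (by fun_prop) continuous_const))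
  · have := hN.2.1.abs_apply_le_trace p q
    rw [hN.2.2] at this
    exact abs_le.1 this

theorem isCompact_relaxedMomentMatrices {n a l : ℕ} (h : a ≤ l) :
    IsCompact (relaxedMomentMatrices n a l) := by
  have hc : Continuous fun N : TensorMatrix n l => partialTrace h N := by
    unfold partialTrace
    fun_prop
  have heq : relaxedMomentMatrices n a l = (fun N => partialTrace h N) ''
      {N : TensorMatrix n l | IsMaxSymmetric N ∧ N.PosSemidef ∧ N.trace = 1} ∩
      {M | IsMaxSymmetric M} := by
    ext M
    constructor
    · rintro ⟨h1, _, N, h2, h3, h4, h5⟩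
      exact ⟨⟨N, ⟨h2, h3, h4⟩, h5⟩, h1⟩
    · rintro ⟨⟨N, ⟨h2, h3, h4⟩, h5⟩, h1⟩
      exact ⟨h1, h, N, h2, h3, h4, h5⟩
  rw [heq]
  exact ((isCompact_maxSymmetric_states n l).image hc).inter_right (isClosed_isMaxSymmetric n a)

theorem isCompact_sphereValues {n : ℕ} (T : MvPolynomial (Fin n) ℝ) : IsCompact (sphereValues T) :=
  (isCompact_sphere 0 1).image ((MvPolynomial.continuous_eval T).comp (by fun_prop))

theorem sphereValues_nonempty {n : ℕ} (hn : 1 ≤ n) (T : MvPolynomial (Fin n) ℝ) :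
    (sphereValues T).Nonempty :=
  ⟨_, EuclideanSpace.single ⟨0, hn⟩ 1, by simp, rfl⟩

theorem sphereValues_subset_relaxationValues {n a l : ℕ} (h : a ≤ l) {T : MvPolynomial (Fin n) ℝ}
    (hT : T.IsHomogeneous (2 * a)) : sphereValues T ⊆ relaxationValues a l T := by
  rintro _ ⟨x, hx, rfl⟩
  exact ⟨pureTensorMatrix a fun i => x i, pureTensorMatrix_mem_relaxedMomentMatrices h
    (eval_sqNorm_of_norm_eq_one (by simpa using hx)),
    trace_polynomialMatrix_mul_pureTensorMatrix hT _⟩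

/-! ### The constant case, the consequences of the bound on the level, and the conclusion. -/

theorem trace_polynomialMatrix_mul_partialTrace_of_isHomogeneous_zero {n l : ℕ} (h : 0 ≤ l)
    {T : MvPolynomial (Fin n) ℝ} (hT : T.IsHomogeneous 0) {N : TensorMatrix n l}
    (hN : IsMaxSymmetric N) (htr : N.trace = 1) (y : Fin n → ℝ) :
    (polynomialMatrix 0 T * partialTrace h N).trace = eval y T := by
  obtain ⟨L, hL⟩ := hN.exists_moment
  rw [trace_polynomialMatrix_mul_partialTrace h (by simpa using hT) hL,
    totalDegree_eq_zero_iff_eq_C.1 (Nat.le_zero.1 hT.totalDegree_le), mul_comm, ← smul_eq_C_mul,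
    map_smul, sqNorm_pow_eq_sum, map_sum, eval_C]
  simp only [hL]
  have h1 : ∑ w, N w w = 1 := htr
  simp [h1]

theorem le_level_of_lt {n a l : ℕ} (hn : 1 ≤ n)
    (hl : 2 * (a : ℝ) ^ 2 * ((a : ℝ) + (n : ℝ) / 2 - 1) - (n : ℝ) / 2 < (l : ℝ)) : a ≤ l := by
  obtain rfl | ha := Nat.eq_zero_or_pos a
  · exact Nat.zero_le l
  have ha' : (1 : ℝ) ≤ a := by exact_mod_cast ha
  have hn' : (1 : ℝ) ≤ n := by exact_mod_cast hn
  -- The lower bound on `l` exceeds a - 1 by at least 1/2: their difference is the sum of the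
  -- left-out terms in `h2` and `h3` plus 1/2.
  have h1 : (a : ℝ) < l + 1 := by
    have h2 : 0 ≤ ((n : ℝ) - 1) * ((a : ℝ) ^ 2 - 1 / 2) := mul_nonneg (by linarith) (by nlinarith)
    have h3 : 0 ≤ (a : ℝ) * (2 * a + 1) * (a - 1) := mul_nonneg (by positivity) (by linarith)
    nlinarith
  exact Nat.lt_succ_iff.1 (by exact_mod_cast h1)

theorem relaxationError_le_one {n a l : ℕ} (hn : 1 ≤ n)
    (hl : 2 * (a : ℝ) ^ 2 * ((a : ℝ) + (n : ℝ) / 2 - 1) - (n : ℝ) / 2 < (l : ℝ)) :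
    relaxationError n a l ≤ 1 := by
  have hn' : (1 : ℝ) ≤ n := by exact_mod_cast hn
  rw [relaxationError, div_le_one (by positivity)]
  linarith

theorem corollary6p2 (n a l : ℕ) (hn : 1 ≤ n)
    (hl : 2 * (a : ℝ) ^ 2 * ((a : ℝ) + (n : ℝ) / 2 - 1) - (n : ℝ) / 2 < (l : ℝ))
    (T : MvPolynomial (Fin n) ℝ) (hT : T.IsHomogeneous (2 * a)) :
    ∃ νl ν νmin : ℝ,
      IsGreatest (relaxationValues a l T) νl ∧
      IsGreatest (sphereValues T) ν ∧
      IsLeast (sphereValues T) νmin ∧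
      |νl - ν| ≤ 4 * (a : ℝ) ^ 2 * ((a : ℝ) + (n : ℝ) / 2 - 1) / (2 * (l : ℝ) + (n : ℝ))
        * (ν - νmin) := by
  have hal := le_level_of_lt hn hl
  have hsub := sphereValues_subset_relaxationValues hal hT
  have hne := sphereValues_nonempty hn T
  obtain ⟨ν, hν⟩ := (isCompact_sphereValues T).exists_isGreatest hne
  obtain ⟨μ, hμ⟩ := (isCompact_sphereValues T).exists_isLeast hne
  have hcomp : IsCompact (relaxationValues a l T) :=
    (isCompact_relaxedMomentMatrices hal).image (by fun_prop)
  obtain ⟨νl, hνl⟩ := hcomp.exists_isGreatest (hne.mono hsub)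
  refine ⟨νl, ν, μ, hνl, hν, hμ, ?_⟩
  have hle : ν ≤ νl := hνl.2 (hsub hν.1)
  have hμν : μ ≤ ν := hμ.2 hν.1
  have hx : ∀ x : EuclideanSpace ℝ (Fin n), ‖x‖ = 1 → eval (fun i => x i) T ∈ sphereValues T :=
    fun x hx => ⟨x, by simpa using hx, rfl⟩
  rw [abs_of_nonneg (by linarith), sub_le_iff_le_add', ← relaxationError]
  obtain ⟨_, ⟨_, _, N, hN, hpos, htr, rfl⟩, rfl⟩ := hνl.1
  -- For `a = 0` the error is 0, so the objective must equal ν exactly; the estimates above divide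
  -- by `a` and do not cover this case.
  obtain rfl | ha := Nat.eq_zero_or_pos a
  · obtain ⟨x, _, hxν⟩ := hν.1
    dsimp only
    rw [trace_polynomialMatrix_mul_partialTrace_of_isHomogeneous_zero _ (by simpa using hT) hN htr
      (fun i => x i)]
    simp only at hxν
    simp [relaxationError, hxν]
  · exact trace_polynomialMatrix_mul_partialTrace_le hn ha hal (relaxationError_le_one hn hl) hT
      (fun x h => hν.2 (hx x h)) (fun x h => hμ.2 (hx x h)) hμν hN hpos htr
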